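/- **Setting.** Variables are linearly ordered ($x_1,x_2,\dots$). A *literal* is $P(\bar x)$ or $\neg P(\bar x)$ with $P/k$ a predicate of arity $k\ge 0$ and $\bar x$ a $k$-tuple of variables; a *clause* is a universally quantified finite disjunction of literals; a *CNF query* $Q$ is a finite conjunction of clauses. So $Q$ contains no constants ($Q$ is *shattered*). $Q$ is *ranked* if the variables of each of its atoms $P(x_{i_1},\dots,x_{i_k})$ satisfy $i_1<\dots<i_k$. A tuple-independent probabilistic database (PDB) over a domain $D$ of size $n\ge 1$ assigns a probability in $[0,1]$ to every ground atom over $D$; $\Pr(Q)$ is the sum, over all worlds (sets of true ground atoms over $D$ of the predicates of $Q$) satisfying $Q$, of the product of the probabilities of the ground literals true in that world. Implication and equivalence are over nonempty domains. A *prime implicate* of $Q$ is a clause $C$ implied by $Q$ such that every clause $C'$ with $Q\Rightarrow C'\Rightarrow C$ is equivalent to $C$ and has at least as many literals. A *connected component* of $C$ is a minimal nonempty set of its literals sharing no variable with the rest of $C$. A clause $D$ *subsumes* $C$ if $D\sigma\subseteq C$ for some substitution $\sigma$ of variables by variables, and $|D|\le|C|$. *Separator variables* for $Q=\bigwedge_i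 C_i$ are variables $x_i$ such that $x_i$ occurs in every atom of $C_i$, at a position that depends only on the predicate of the atom (the same for all clauses). **Algorithm $\mathrm{Lift}^R$**, on a query $Q$ and a PDB with domain $D$. First simplify $Q$: remove redundant clauses and redundant literals until none is left. 0. If $Q$ is the empty conjunction, return $1$; if $Q$ contains the empty clause, return $0$; if $Q$ is a single ground literal, return its probability. 1. Take all ranked prime implicates (up to equivalence) that have more than one connected component and each of whose components subsumes some clause of $Q$. For each way of choosing one component of each of them, conjoin the chosen components to $Q$; simplify the resulting CNFs and discard redundant ones, obtaining $Q\equiv Q_1\vee\dots\vee Q_m$. 2. If $m>1$ and $\{Q_1,\dots,Q_m\}$ can be partitioned into two nonempty parts without common predicates, with disjunctions $Q',Q''$ (rewritten as CNFs), return $1-(1-\Pr(Q'))(1-\Pr(Q''))$. 3. If $m>1$ and there is no such partition, return $\sum_{K}c_K\Pr(K)$, where $K$ runs over representatives of the equivalence classes of the conjunctions $\bigwedge_{i\in s}Q_i$, $\emptyset\ne s\subseteq\{1,\dots,m\}$, and $c_K=\sum_{s:\,\bigwedge_{i\in s}Q_i\equiv K}(-1)^{|s|+1}$; the terms with $c_K=0$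 are cancelled, i.e. not computed. 4. (If $m=1$.) Take the CNF $Q=C_1\wedge\dots\wedge C_r$. 5. If its clauses can be partitioned into two nonempty parts $Q',Q''$ without common predicates, return $\Pr(Q')\cdot\Pr(Q'')$. 6. If $Q$ has separator variables $x_1,\dots,x_r$, return $\prod_{a\in D}\Pr(C_1[a/x_1]\wedge\dots\wedge C_r[a/x_r])$, where the instantiated atoms of each predicate are regarded as atoms of a predicate of arity one less. Otherwise FAIL. All probabilities on the right-hand sides are computed recursively; a call fails as soon as one of its recursive calls fails. The choices left open (which simplification, representatives, partition, separator variables) are resolved by an arbitrary rule depending on the query only. Running time is data complexity with unit costs: each call, database look-up and arithmetic operation on real numbers takes one step, and each call takes in addition, for processing its query, a number of steps which is an arbitrary function of that query. **Theorem.** Let $Q$ be a ranked, shattered CNF query and let $k$ be the largest arity of a predicate of $Q$. For every way of resolving the open choices, one of the following holds: 1. $\mathrm{Lift}^R$ fails on $Q$: for every domain of size $n\ge1$ and every PDB over it, it halts with answer FAIL; or 2. there is a constant $c$ (depending on $Q$ and on the way the query processing is done, but not on $n$ or the PDB) such that for every $n\ge 1$ and every PDB over a domain of size $n$, $\mathrm{Lift}^R$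 halts after at most $c\,n^k$ steps and returns $\Pr(Q)$. -/

import Mathlib

namespace LiftR

/-! ## Queries -/

/-- A constant-free literal `P(x₁, …, x_k)` or `¬P(x₁, …, x_k)`.  Variables are natural numbers.
A predicate is a name together with an arity, the number of arguments of the literal. -/
structure Literal (ρ : Type*) where
  pos : Bool
  rel : ρ
  args : List ℕ
deriving DecidableEq

/-- A clause: the universally quantified disjunction of its literals. -/
abbrev Clause (ρ : Type*) := Finset (Literal ρ)

/-- A CNF query: the conjunction of its clauses. -/
abbrev CNF (ρ : Type*) := Finset (Clause ρ)

variable {ρ : Type*}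

def Literal.vars (l : Literal ρ) : Finset ℕ := l.args.toFinset

/-- The predicate symbol `P/k` of a literal. -/
def Literal.symbol (l : Literal ρ) : ρ × ℕ := (l.rel, l.args.length)

def Literal.rename (σ : ℕ → ℕ) (l : Literal ρ) : Literal ρ := ⟨l.pos, l.rel, l.args.map σ⟩

def Clause.vars (C : Clause ρ) : Finset ℕ := C.biUnion Literal.vars

def Clause.rename [DecidableEq ρ] (σ : ℕ → ℕ) (C : Clause ρ) : Clause ρ :=
  C.image (Literal.rename σ)

def CNF.symbols [DecidableEq ρ] (Q : CNF ρ) : Finset (ρ × ℕ) :=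
  Q.biUnion fun C => C.image Literal.symbol

/-- The largest arity of a predicate symbol of `Q`. -/
def CNF.maxArity [DecidableEq ρ] (Q : CNF ρ) : ℕ := Q.symbols.sup Prod.snd

/-- The arguments of every literal are strictly increasing in the order of the variables. -/
def Clause.Ranked (C : Clause ρ) : Prop := ∀ l ∈ C, l.args.Pairwise (· < ·)

def CNF.Ranked (Q : CNF ρ) : Prop := ∀ C ∈ Q, Clause.Ranked C

/-! ## Semantics -/

/-- A world over the domain `D`: which ground atoms are true. -/
abbrev World (ρ : Type*) (D : Type*) := ρ → List D → Prop

def Literal.Holds {D : Type*} (I : World ρ D) (v : ℕ → D) (l : Literal ρ) : Prop :=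
  if l.pos then I l.rel (l.args.map v) else ¬ I l.rel (l.args.map v)

def Clause.Holds {D : Type*} (I : World ρ D) (C : Clause ρ) : Prop :=
  ∀ v : ℕ → D, ∃ l ∈ C, l.Holds I v

def CNF.Holds {D : Type*} (I : World ρ D) (Q : CNF ρ) : Prop :=
  ∀ C ∈ Q, Clause.Holds I C

/-- Logical implication (over all nonempty domains). -/
def Entails (Q Q' : CNF ρ) : Prop :=
  ∀ (D : Type) [Nonempty D] (I : World ρ D), Q.Holds I → Q'.Holds I

/-- Logical equivalence. -/
def Equivalent (Q Q' : CNF ρ) : Prop := Entails Q Q' ∧ Entails Q' Q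

/-! ## Probabilistic databases -/

/-- A tuple-independent probabilistic database over the domain `Fin n`. -/
structure PDB (ρ : Type*) (n : ℕ) where
  prob : ρ → List (Fin n) → ℝ
  nonneg : ∀ R t, 0 ≤ prob R t
  le_one : ∀ R t, prob R t ≤ 1

/-- All ground atoms over the domain `Fin n` of the predicate symbols of `Q`. -/
def groundAtoms [DecidableEq ρ] (n : ℕ) (Q : CNF ρ) : Finset (ρ × List (Fin n)) :=
  Q.symbols.biUnion fun s =>
    (Finset.univ : Finset (Fin s.2 → Fin n)).image fun t => (s.1, List.ofFn t)

open Classical in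
/-- `Pr(Q)`: the sum over all worlds (given by their sets `I` of true ground atoms) satisfying `Q`
of the product of the probabilities of their ground literals. -/
noncomputable def Pr [DecidableEq ρ] {n : ℕ} (P : PDB ρ n) (Q : CNF ρ) : ℝ :=
  ∑ I ∈ (groundAtoms n Q).powerset,
    if Q.Holds (fun R t => (R, t) ∈ I) then
      ∏ g ∈ groundAtoms n Q, (if g ∈ I then P.prob g.1 g.2 else 1 - P.prob g.1 g.2)
    else 0

/-- The probability of the ground literal `l`, a literal without arguments. -/
def PDB.literal {n : ℕ} (P : PDB ρ n) (l : Literal ρ) : ℝ :=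
  if l.pos then P.prob l.rel [] else 1 - P.prob l.rel []

/-! ## Prime implicates and union-CNF -/

/-- A clause entailed by `Q`. -/
def IsImplicate (Q : CNF ρ) (C : Clause ρ) : Prop := Entails Q {C}

/-- `C` is an implicate of `Q`, and no other implicate of `Q` implies `C`, where the implicates
that are equivalent to `C` and not shorter than `C` are not counted as other ones. -/
def IsPrimeImplicate (Q : CNF ρ) (C : Clause ρ) : Prop :=
  IsImplicate Q C ∧
    ∀ C' : Clause ρ, IsImplicate Q C' → Entails {C'} {C} → Entails {C} {C'} ∧ C.card ≤ C'.card

/-- `S` is a nonempty set of literals of `C` sharing no variables with the rest of `C`. -/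
def IsSeparated (C S : Clause ρ) : Prop :=
  S ⊆ C ∧ S.Nonempty ∧ ∀ l ∈ S, ∀ l' ∈ C, l' ∉ S → Disjoint l.vars l'.vars

/-- A connected component of `C`: a minimal separated set of literals. -/
def IsComponent (C S : Clause ρ) : Prop :=
  IsSeparated C S ∧ ∀ T, IsSeparated C T → T ⊆ S → T = S

open Classical in
noncomputable def components (C : Clause ρ) : Finset (Clause ρ) :=
  C.powerset.filter (IsComponent C)

/-- `D` subsumes `C`: some instance of `D` is contained in `C`, and `D` is not longer than `C`. -/
def Subsumes [DecidableEq ρ] (D C : Clause ρ) : Prop :=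
  (∃ σ : ℕ → ℕ, Clause.rename σ D ⊆ C) ∧ D.card ≤ C.card

/-- The prime implicates used to write `Q` as a union: the disconnected (ranked) ones each of whose
connected components subsumes some clause of `Q`. -/
def IsSplitting [DecidableEq ρ] (Q : CNF ρ) (C : Clause ρ) : Prop :=
  C.Ranked ∧ IsPrimeImplicate Q C ∧ 1 < (components C).card ∧
    ∀ D ∈ components C, ∃ C' ∈ Q, Subsumes D C'

/-- Distributivity: for implicates `𝒞` of `Q`, the CNFs `Q ∧ ⋀_{C ∈ 𝒞} D_C`, one for each way to
choose a component `D_C` of each `C ∈ 𝒞`.  Their disjunction is equivalent to `Q`. -/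
noncomputable def distribute [DecidableEq ρ] (𝒞 : Finset (Clause ρ)) (Q : CNF ρ) :
    Finset (CNF ρ) :=
  (𝒞.pi fun C => components C).image fun f => Q ∪ 𝒞.attach.image fun C => f C.1 C.2

/-- `R` is obtained from `Q` by removing redundant clauses and redundant literals, until none is
left.  For an unsatisfiable `Q` it is `{∅}`, for a valid `Q` it is `∅`. -/
def IsSimplification [DecidableEq ρ] (Q R : CNF ρ) : Prop :=
  Equivalent Q R ∧ (∀ C ∈ R, ∃ C' ∈ Q, C ⊆ C') ∧
    (∀ C ∈ R, ¬ Entails (R.erase C) {C}) ∧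
    ∀ C ∈ R, ∀ l ∈ C, ¬ IsImplicate R (C.erase l)

/-- `U = [Q₁, …, Q_m]` is a union-CNF `Q₁ ∨ ⋯ ∨ Q_m` of `Q`: it arises by distributivity from all
disconnected prime implicates of the kind above (up to equivalence), after simplifying the
resulting CNFs and removing the redundant ones among them. -/
def IsUnionCNF [DecidableEq ρ] (simplify : CNF ρ → CNF ρ) (Q : CNF ρ) (U : List (CNF ρ)) : Prop :=
  ∃ 𝒞 : Finset (Clause ρ),
    (∀ C ∈ 𝒞, IsSplitting Q C) ∧
    (∀ C, IsSplitting Q C → ∃ C' ∈ 𝒞, Equivalent {C} {C'}) ∧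
    (∀ q ∈ U, ∃ d ∈ distribute 𝒞 Q, q = simplify d) ∧
    (∀ d ∈ distribute 𝒞 Q, ∃ q ∈ U, Entails d q) ∧
    U.Pairwise fun q q' => ¬ Entails q q' ∧ ¬ Entails q' q

/-! ## The rules of the algorithm -/

/-- A partition of the union `U` into two nonempty parts without common predicate symbols. -/
def IsUnionPartition [DecidableEq ρ] (U : List (CNF ρ)) (p : List (CNF ρ) × List (CNF ρ)) : Prop :=
  p.1 ≠ [] ∧ p.2 ≠ [] ∧ U.Perm (p.1 ++ p.2) ∧
    ∀ q ∈ p.1, ∀ q' ∈ p.2, Disjoint q.symbols q'.symbols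

/-- A partition of the clauses of `Q` into two nonempty sets without common predicate symbols. -/
def IsClausePartition [DecidableEq ρ] (Q : CNF ρ) (p : CNF ρ × CNF ρ) : Prop :=
  p.1.Nonempty ∧ p.2.Nonempty ∧ p.1 ∪ p.2 = Q ∧ Disjoint p.1.symbols p.2.symbols

/-- The CNF of `q ∨ r`, with the variables of `r` renamed apart (by an order-preserving shift). -/
def CNF.or [DecidableEq ρ] (q r : CNF ρ) : CNF ρ :=
  Finset.image₂ (fun C D : Clause ρ => C ∪ D.rename (· + (C.vars.sup id + 1))) q r

/-- The CNF of a disjunction of CNFs. -/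
def disjunction [DecidableEq ρ] (U : List (CNF ρ)) : CNF ρ := U.foldr CNF.or {∅}

/-- The conjunction `⋀_{i ∈ s} Q_i` of members of `U = [Q₁, …, Q_m]`. -/
def conjunction [DecidableEq ρ] (U : List (CNF ρ)) (s : Finset (Fin U.length)) : CNF ρ :=
  s.biUnion fun i => U.get i

/-- `T` lists one representative of each equivalence class of the conjunctions that occur in the
inclusion/exclusion formula for `U`. -/
def IsTermList [DecidableEq ρ] (U T : List (CNF ρ)) : Prop :=
  (∀ q ∈ T, ∃ s : Finset (Fin U.length), s.Nonempty ∧ q = conjunction U s) ∧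
    (∀ s : Finset (Fin U.length), s.Nonempty → ∃ q ∈ T, Equivalent (conjunction U s) q) ∧
    T.Pairwise fun q q' => ¬ Equivalent q q'

open Classical in
/-- The total coefficient, in the inclusion/exclusion formula for `U`, of the conjunctions that are
equivalent to `q`. -/
noncomputable def coefficient [DecidableEq ρ] (U : List (CNF ρ)) (q : CNF ρ) : ℤ :=
  ∑ s : Finset (Fin U.length),
    if s.Nonempty ∧ Equivalent (conjunction U s) q then (-1) ^ (s.card + 1) else 0

/-- A choice of separator variables for `Q`: the variable `sep.1 C` of the clause `C` occurs in each
literal of `C`, for literals of the predicate `R/k` at position `sep.2 R k`. -/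
def IsSeparator (Q : CNF ρ) (sep : (Clause ρ → ℕ) × (ρ → ℕ → ℕ)) : Prop :=
  ∀ C ∈ Q, ∀ l ∈ C, l.args[sep.2 l.rel l.args.length]? = some (sep.1 C)

/-- The query `⋀ C_i[a/x_i]` for separator variables `x_i` at the positions `pos`.  As `a` is at the
same position in all atoms `R(…, a, …)` of a predicate, they are written as atoms of a predicate
whose arity is smaller by one (and whose probabilities are given by `PDB.restrict`). -/
def CNF.instantiate [DecidableEq ρ] (Q : CNF ρ) (pos : ρ → ℕ → ℕ) : CNF ρ :=
  Q.image fun C => C.image fun l =>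
    ⟨l.pos, l.rel, l.args.eraseIdx (pos l.rel l.args.length)⟩

/-- The tuples with the constant `a` at the positions `pos`, with that entry left out. -/
def PDB.restrict {n : ℕ} (P : PDB ρ n) (pos : ρ → ℕ → ℕ) (a : Fin n) : PDB ρ n where
  prob R t := P.prob R (t.insertIdx (pos R (t.length + 1)) a)
  nonneg _ _ := P.nonneg _ _
  le_one _ _ := P.le_one _ _

/-! ## The algorithm -/

/-- A way to resolve the choices that the algorithm leaves open.  They depend on the query only, and
so does `work Q`, the time (an arbitrary function of `Q`) that a call with query `Q` spends on them
outside the recursive calls. -/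
structure Implementation (ρ : Type*) [DecidableEq ρ] where
  simplify : CNF ρ → CNF ρ
  simplify_spec : ∀ Q, IsSimplification Q (simplify Q)
  union : CNF ρ → List (CNF ρ)
  union_spec : ∀ Q, IsUnionCNF simplify Q (union Q)
  unionPartition : List (CNF ρ) → List (CNF ρ) × List (CNF ρ)
  unionPartition_spec :
    ∀ U, (∃ p, IsUnionPartition U p) → IsUnionPartition U (unionPartition U)
  terms : List (CNF ρ) → List (CNF ρ)
  terms_spec : ∀ U, IsTermList U (terms U)
  clausePartition : CNF ρ → CNF ρ × CNF ρ
  clausePartition_spec :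
    ∀ Q, (∃ p, IsClausePartition Q p) → IsClausePartition Q (clausePartition Q)
  separator : CNF ρ → (Clause ρ → ℕ) × (ρ → ℕ → ℕ)
  separator_spec : ∀ Q, (∃ sep, IsSeparator Q sep) → IsSeparator Q (separator Q)
  work : CNF ρ → ℕ

/-- The state of a computation: not finished within the given recursion depth, or finished after
`time` steps with the answer FAIL or with a number. -/
inductive Outcome where
  | running : Outcome
  | fail (time : ℕ) : Outcome
  | value (r : ℝ) (time : ℕ) : Outcome

/-- `t` further steps. -/
def Outcome.delay (t : ℕ) : Outcome → Outcome
  | running => running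
  | fail t' => fail (t + t')
  | value r t' => value r (t + t')

/-- Sequential execution. -/
def Outcome.bind (o : Outcome) (f : ℝ → Outcome) : Outcome :=
  match o with
  | running => running
  | fail t => fail t
  | value r t => (f r).delay t

/-- Run all computations and combine their values by a binary operation, one step for each. -/
def Outcome.fold (op : ℝ → ℝ → ℝ) (init : ℝ) : List Outcome → Outcome
  | [] => value init 0
  | o :: os => o.bind fun x => (fold op init os).bind fun y => value (op x y) 1

open Classical in
/-- The algorithm, run on the query `Q₀` and the database `P` with recursion depth at most the first
argument.  Every call, every database look-up and every arithmetic operation takes one step, and a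
call with query `Q₀` takes `S.work Q₀` steps for processing the query. -/
noncomputable def lift [DecidableEq ρ] (S : Implementation ρ) :
    ℕ → CNF ρ → {n : ℕ} → PDB ρ n → Outcome
  | 0, _, _, _ => .running
  | depth + 1, Q₀, n, P =>
    let Q := S.simplify Q₀
    let U := S.union Q
    Outcome.delay (S.work Q₀ + 1) <|
      -- Constants and ground literals.
      if Q = ∅ then .value 1 0
      else if ∅ ∈ Q then .value 0 0
      else if h : ∃ l : Literal ρ, Q = {{l}} ∧ l.args = [] then
        .value (P.literal h.choose) 2
      else if 1 < U.length then
        if ∃ p, IsUnionPartition U p then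
          -- Decomposable disjunction.
          let p := S.unionPartition U
          (lift S depth (disjunction p.1) P).bind fun x =>
            (lift S depth (disjunction p.2) P).bind fun y =>
              .value (1 - (1 - x) * (1 - y)) 4
        else
          -- Inclusion/exclusion, after cancellations.
          Outcome.fold (· + ·) 0 <|
            ((S.terms U).filter fun q => coefficient U q ≠ 0).map fun q =>
              (lift S depth q P).bind fun x => .value (coefficient U q * x) 1
      else if ∃ p, IsClausePartition Q p then
        -- Decomposable conjunction.
        let p := S.clausePartition Q
        (lift S depth p.1 P).bind fun x =>
          (lift S depth p.2 P).bind fun y => .value (x * y) 1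
      else if ∃ sep, IsSeparator Q sep then
        -- Decomposable universal quantifier.
        let pos := (S.separator Q).2
        Outcome.fold (· * ·) 1 <|
          (List.finRange n).map fun a =>
            lift S depth (Q.instantiate pos) (P.restrict pos a)
      else .fail 0

/-- The algorithm halts on `Q` with answer FAIL, whatever the (nonempty) domain and the database. -/
def FailsOn [DecidableEq ρ] (S : Implementation ρ) (Q : CNF ρ) : Prop :=
  ∀ n : ℕ, 1 ≤ n → ∀ P : PDB ρ n, ∃ depth t, lift S depth Q P = .fail t

/-- The algorithm halts on `Q` and `P` after exactly `t` steps and returns `r`. -/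
def Computes [DecidableEq ρ] (S : Implementation ρ) (Q : CNF ρ) {n : ℕ} (P : PDB ρ n) (r : ℝ)
    (t : ℕ) : Prop :=
  ∃ depth, lift S depth Q P = .value r t

/-! ## Implementations exist -/

section Existence

theorem Entails.refl (Q : CNF ρ) : Entails Q Q := fun _ _ _ h => h

theorem Entails.trans {Q Q' Q'' : CNF ρ} (h : Entails Q Q') (h' : Entails Q' Q'') :
    Entails Q Q'' := fun D _ I hQ => h' D I (h D I hQ)

theorem Clause.Holds.mono {D : Type*} {I : World ρ D} {C C' : Clause ρ} (h : C ⊆ C')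
    (hC : C.Holds I) : C'.Holds I := fun v =>
  let ⟨l, hl, hl'⟩ := hC v
  ⟨l, h hl, hl'⟩

theorem Clause.Holds.rename [DecidableEq ρ] {D : Type*} {I : World ρ D} {C : Clause ρ} (σ : ℕ → ℕ)
    (hC : C.Holds I) : (C.rename σ).Holds I := fun v => by
  obtain ⟨l, hl, h⟩ := hC (v ∘ σ)
  refine ⟨l.rename σ, Finset.mem_image_of_mem _ hl, ?_⟩
  simpa [Literal.Holds, Literal.rename] using h

theorem exists_simplification [DecidableEq ρ] (Q : CNF ρ) : ∃ R, IsSimplification Q R := by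
  classical
  let K : Finset (CNF ρ) := (Q.biUnion Finset.powerset).powerset.filter (Equivalent Q)
  have hmem : ∀ R, R ∈ K ↔ (∀ C ∈ R, ∃ C' ∈ Q, C ⊆ C') ∧ Equivalent Q R := by
    intro R
    simp [K, Finset.subset_iff (s₁ := R)]
  have hK : K.Nonempty :=
    ⟨Q, (hmem Q).2 ⟨fun C hC => ⟨C, hC, subset_rfl⟩, Entails.refl Q, Entails.refl Q⟩⟩
  obtain ⟨R, hR, hmin⟩ := K.exists_min_image (fun R => ∑ C ∈ R, (C.card + 1)) hK
  obtain ⟨hsub, h1, h2⟩ := (hmem R).1 hR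
  refine ⟨R, ⟨h1, h2⟩, hsub, fun C hC hred => ?_, fun C hC l hl himp => ?_⟩
  · have hlt : R.erase C ∈ K := by
      refine (hmem _).2 ⟨fun C' hC' => hsub C' (Finset.mem_of_mem_erase hC'), ?_, ?_⟩
      · exact fun D _ I hQ C' hC' => h1 D I hQ C' (Finset.mem_of_mem_erase hC')
      · refine Entails.trans (fun D _ I hI C' hC' => ?_) h2
        by_cases hc : C' = C
        · subst hc
          exact hred D I hI _ (Finset.mem_singleton_self _)
        · exact hI C' (Finset.mem_erase.2 ⟨hc, hC'⟩)
    have := hmin _ hlt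
    have h3 := Finset.add_sum_erase R (fun C => C.card + 1) hC
    omega
  · have hlt : insert (C.erase l) (R.erase C) ∈ K := by
      refine (hmem _).2 ⟨fun C' hC' => ?_, ?_, ?_⟩
      · rcases Finset.mem_insert.1 hC' with rfl | hC'
        · obtain ⟨C', h, h'⟩ := hsub C hC
          exact ⟨C', h, (Finset.erase_subset _ _).trans h'⟩
        · exact hsub C' (Finset.mem_of_mem_erase hC')
      · refine Entails.trans h1 fun D _ I hI C' hC' => ?_
        rcases Finset.mem_insert.1 hC' with rfl | hC'
        · exact himp D I hI _ (Finset.mem_singleton_self _)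
        · exact hI C' (Finset.mem_of_mem_erase hC')
      · refine Entails.trans (fun D _ I hI C' hC' => ?_) h2
        by_cases hc : C' = C
        · subst hc
          exact (hI _ (Finset.mem_insert_self _ _)).mono (Finset.erase_subset _ _)
        · exact hI C' (Finset.mem_insert_of_mem (Finset.mem_erase.2 ⟨hc, hC'⟩))
    have := hmin _ hlt
    have h3 := Finset.add_sum_erase R (fun C => C.card + 1) hC
    have h4 : ∑ C' ∈ insert (C.erase l) (R.erase C), (C'.card + 1) ≤
        ((C.erase l).card + 1) + ∑ C' ∈ R.erase C, (C'.card + 1) := by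
      by_cases hin : C.erase l ∈ R.erase C
      · rw [Finset.insert_eq_of_mem hin]
        omega
      · rw [Finset.sum_insert hin]
    have h5 := Finset.card_erase_lt_of_mem hl
    omega

theorem exists_component (C : Clause ρ) {l : Literal ρ} (hl : l ∈ C) :
    ∃ S, IsComponent C S ∧ l ∈ S := by
  classical
  let K := C.powerset.filter fun S => IsSeparated C S ∧ l ∈ S
  have hK : K.Nonempty := ⟨C, by
    simp only [K, Finset.mem_filter, Finset.mem_powerset]
    exact ⟨subset_rfl, ⟨subset_rfl, ⟨l, hl⟩, fun _ _ l' h h' => absurd h h'⟩, hl⟩⟩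
  obtain ⟨S, hS, hmin⟩ := K.exists_min_image Finset.card hK
  simp only [K, Finset.mem_filter, Finset.mem_powerset] at hS hmin
  obtain ⟨hSC, hsep, hlS⟩ := hS
  refine ⟨S, ⟨hsep, fun T hT hTS => ?_⟩, hlS⟩
  by_cases hlT : l ∈ T
  · exact Finset.eq_of_subset_of_card_le hTS (hmin T ⟨hT.1, hT, hlT⟩)
  · exfalso
    have h1 : IsSeparated C (S \ T) := by
      refine ⟨Finset.sdiff_subset.trans hSC, ⟨l, Finset.mem_sdiff.2 ⟨hlS, hlT⟩⟩, ?_⟩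
      intro a ha b hb hb'
      rw [Finset.mem_sdiff] at ha
      by_cases hbS : b ∈ S
      · have hbT : b ∈ T := by
          by_contra h
          exact hb' (Finset.mem_sdiff.2 ⟨hbS, h⟩)
        exact (hT.2.2 b hbT a (hSC ha.1) ha.2).symm
      · exact hsep.2.2 a ha.1 b hb hbS
    have h2 := hmin _ ⟨h1.1, h1, Finset.mem_sdiff.2 ⟨hlS, hlT⟩⟩
    obtain ⟨t, ht⟩ := hT.2.1
    have h3 : (S \ T).card < S.card := Finset.card_lt_card
      (Finset.ssubset_iff_of_subset Finset.sdiff_subset |>.2 ⟨t, hTS ht, by simp [ht]⟩)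
    omega

theorem IsComponent.eq_of_not_disjoint {C S T : Clause ρ} (hS : IsComponent C S)
    (hT : IsComponent C T) {l l' : Literal ρ} (hl : l ∈ S) (hl' : l' ∈ T)
    (h : ¬ Disjoint l.vars l'.vars) : S = T := by
  classical
  have hlT : l' ∈ S := by
    by_contra hn
    exact h (hS.1.2.2 l hl l' (hT.1.1 hl') hn)
  have hsep : IsSeparated C (S ∩ T) := by
    refine ⟨Finset.inter_subset_left.trans hS.1.1, ⟨l', Finset.mem_inter.2 ⟨hlT, hl'⟩⟩, ?_⟩
    intro a ha b hb hb'
    rw [Finset.mem_inter] at ha hb'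
    by_cases hbS : b ∈ S
    · exact hT.1.2.2 a ha.2 b hb fun hbT => hb' ⟨hbS, hbT⟩
    · exact hS.1.2.2 a ha.1 b hb hbS
  rw [← hS.2 _ hsep Finset.inter_subset_left, ← hT.2 _ hsep Finset.inter_subset_right]
  simp

theorem mem_components {C S : Clause ρ} : S ∈ components C ↔ IsComponent C S := by
  simp only [components, Finset.mem_filter, Finset.mem_powerset, and_iff_right_iff_imp]
  exact fun h => h.1.1

/-- A clause is the disjunction of its connected components. -/
theorem holds_iff_exists_component {D : Type*} [Nonempty D] (I : World ρ D) (C : Clause ρ) :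
    C.Holds I ↔ ∃ S ∈ components C, Clause.Holds I S := by
  classical
  constructor
  · intro hC
    by_contra hno
    push Not at hno
    have hv : ∀ S : Clause ρ, ∃ v : ℕ → D, S ∈ components C → ∀ l ∈ S, ¬ l.Holds I v := by
      intro S
      by_cases hS : S ∈ components C
      · have := hno S hS
        simp only [Clause.Holds, not_forall, not_exists, not_and] at this
        obtain ⟨v, hv⟩ := this
        exact ⟨v, fun _ => hv⟩
      · exact ⟨fun _ => Classical.arbitrary D, fun h => absurd h hS⟩
    choose v hv using hv
    let w : ℕ → D := fun x =>
      if h : ∃ S ∈ components C, x ∈ Clause.vars S then v h.choose x else Classical.arbitrary D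
    obtain ⟨l, hl, hlw⟩ := hC w
    obtain ⟨S, hS, hlS⟩ := exists_component C hl
    have hS' := mem_components.2 hS
    refine hv S hS' l hlS ?_
    have hargs : l.args.map w = l.args.map (v S) := by
      refine List.map_congr_left fun x hx => ?_
      have hxl : x ∈ l.vars := List.mem_toFinset.2 hx
      have hex : ∃ S ∈ components C, x ∈ Clause.vars S :=
        ⟨S, hS', Finset.mem_biUnion.2 ⟨l, hlS, hxl⟩⟩
      have heq : hex.choose = S := by
        obtain ⟨h1, h2⟩ := hex.choose_spec
        obtain ⟨l', hl', hx'⟩ := Finset.mem_biUnion.1 h2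
        exact (mem_components.1 h1).eq_of_not_disjoint hS hl' hlS
          (Finset.not_disjoint_iff.2 ⟨x, hx', hxl⟩)
      simp only [w, dif_pos hex, heq]
    simpa only [Literal.Holds, hargs] using hlw
  · rintro ⟨S, hS, hSI⟩
    exact hSI.mono (mem_components.1 hS).1.1

/-- Up to equivalence, there are finitely many clauses of bounded size over given predicates. -/
theorem exists_small_clauses [DecidableEq ρ] (Sy : Finset (ρ × ℕ)) (M : ℕ) :
    ∃ B : Finset (Clause ρ), ∀ C : Clause ρ, C.card ≤ M → (∀ l ∈ C, l.symbol ∈ Sy) →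
      ∃ C' ∈ B, Equivalent {C} {C'} := by
  classical
  let k := Sy.sup Prod.snd
  let N := M * k
  let L : Finset (Literal ρ) := Sy.biUnion fun s =>
    (Finset.univ : Finset (Bool × (Fin s.2 → Fin N))).image fun t =>
      ⟨t.1, s.1, List.ofFn fun i => (t.2 i : ℕ)⟩
  refine ⟨L.powerset, fun C hM hC => ?_⟩
  have hN : C.vars.card ≤ N := by
    refine (Finset.card_biUnion_le_card_mul _ _ k fun l hl => ?_).trans
      (Nat.mul_le_mul_right _ hM)
    exact (List.toFinset_card_le _).trans (Finset.le_sup (f := Prod.snd) (hC l hl))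
  let e := C.vars.equivFin
  let σ : ℕ → ℕ := fun x => if h : x ∈ C.vars then (e ⟨x, h⟩ : ℕ) else 0
  let τ : ℕ → ℕ := fun i => if h : i < C.vars.card then (e.symm ⟨i, h⟩ : ℕ) else 0
  have hτ : ∀ x ∈ C.vars, τ (σ x) = x := by
    intro x hx
    simp [σ, τ, hx]
  have hback : Clause.rename τ (Clause.rename σ C) = C := by
    have : ∀ l ∈ C, (l.rename σ).rename τ = l := by
      intro l hl
      have h : (l.args.map σ).map τ = l.args := by
        rw [List.map_map]
        conv_rhs => rw [← List.map_id l.args]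
        refine List.map_congr_left fun x hx => ?_
        exact hτ x (Finset.mem_biUnion.2 ⟨l, hl, List.mem_toFinset.2 hx⟩)
      simp only [Literal.rename, h]
    rw [Clause.rename, Clause.rename, Finset.image_image]
    ext l
    simp only [Finset.mem_image, Function.comp_apply]
    constructor
    · rintro ⟨l', hl', rfl⟩
      rwa [this l' hl']
    · exact fun hl => ⟨l, hl, this l hl⟩
  refine ⟨Clause.rename σ C, ?_, ?_, ?_⟩
  · rw [Finset.mem_powerset]
    intro l' hl'
    obtain ⟨l, hl, rfl⟩ := Finset.mem_image.1 hl'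
    have hlt : ∀ i : Fin l.args.length, σ (l.args.get i) < N := by
      intro i
      have hx : l.args.get i ∈ C.vars :=
        Finset.mem_biUnion.2 ⟨l, hl, List.mem_toFinset.2 (List.get_mem _ _)⟩
      simp only [σ, dif_pos hx]
      exact (Fin.is_lt _).trans_le hN
    refine Finset.mem_biUnion.2 ⟨l.symbol, hC l hl, Finset.mem_image.2
      ⟨(l.pos, fun i => ⟨σ (l.args.get i), hlt i⟩), Finset.mem_univ _, ?_⟩⟩
    have : List.ofFn (fun i : Fin l.args.length => σ (l.args.get i)) = l.args.map σ := by
      apply List.ext_getElem <;> simp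
    simp only [Literal.rename, Literal.symbol, ← this]
  · intro D _ I hI C' hC'
    obtain rfl := Finset.mem_singleton.1 hC'
    exact (hI C (Finset.mem_singleton_self _)).rename σ
  · intro D _ I hI C' hC'
    obtain rfl := Finset.mem_singleton.1 hC'
    have := (hI _ (Finset.mem_singleton_self _)).rename τ
    rwa [hback] at this

theorem exists_splittings [DecidableEq ρ] (Q : CNF ρ) :
    ∃ 𝒞 : Finset (Clause ρ), (∀ C ∈ 𝒞, IsSplitting Q C) ∧
      ∀ C, IsSplitting Q C → ∃ C' ∈ 𝒞, Equivalent {C} {C'} := by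
  classical
  obtain ⟨B, hB⟩ := exists_small_clauses Q.symbols (Q.sup Finset.card)
  let φ : Clause ρ → Finset (Clause ρ) := fun C =>
    B.filter fun b => ∃ D ∈ components C, Equivalent {D} {b}
  let A : Set (Clause ρ) := {C | IsSplitting Q C}
  have hfin : (φ '' A).Finite := (B.powerset.finite_toSet).subset (by
    rintro _ ⟨C, -, rfl⟩
    exact Finset.mem_coe.2 (Finset.mem_powerset.2 (Finset.filter_subset _ _)))
  obtain ⟨𝒞, h𝒞, him⟩ := Finset.subset_set_image_iff.1
    (show (hfin.toFinset : Set (Finset (Clause ρ))) ⊆ φ '' A by simp)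
  have key : ∀ C C', IsSplitting Q C → φ C = φ C' → Entails {C} {C'} := by
    intro C C' hC hφ D _ I hI E hE
    obtain rfl := Finset.mem_singleton.1 hE
    obtain ⟨S, hS, hSI⟩ := (holds_iff_exists_component I C).1 (hI C (Finset.mem_singleton_self _))
    obtain ⟨F, hF, ⟨σ, hσ⟩, hcard⟩ := hC.2.2.2 S hS
    obtain ⟨b, hb, hSb⟩ := hB S (hcard.trans (Finset.le_sup (f := Finset.card) hF)) (by
      intro l hl
      refine Finset.mem_biUnion.2 ⟨F, hF, Finset.mem_image.2
        ⟨l.rename σ, hσ (Finset.mem_image_of_mem _ hl), ?_⟩⟩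
      simp [Literal.symbol, Literal.rename])
    have hbφ : b ∈ φ C := Finset.mem_filter.2 ⟨hb, S, hS, hSb⟩
    rw [hφ] at hbφ
    obtain ⟨-, S', hS', hSb'⟩ := Finset.mem_filter.1 hbφ
    refine (holds_iff_exists_component I _).2 ⟨S', hS', ?_⟩
    refine hSb'.2 D I (hSb.1 D I ?_) _ (Finset.mem_singleton_self _)
    intro C'' h
    obtain rfl := Finset.mem_singleton.1 h
    exact hSI
  refine ⟨𝒞, fun C hC => h𝒞 hC, fun C hC => ?_⟩
  have : φ C ∈ 𝒞.image φ := by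
    rw [him]
    simpa using ⟨C, hC, rfl⟩
  obtain ⟨C', hC', hφ⟩ := Finset.mem_image.1 this
  exact ⟨C', hC', key C C' hC hφ.symm, key C' C (h𝒞 hC') hφ⟩

theorem exists_maximal_list (L : List (CNF ρ)) :
    ∃ U : List (CNF ρ), (∀ q ∈ U, q ∈ L) ∧ (∀ d ∈ L, ∃ q ∈ U, Entails d q) ∧
      U.Pairwise fun q q' => ¬ Entails q q' ∧ ¬ Entails q' q := by
  classical
  induction L with
  | nil => exact ⟨[], by simp, by simp, by simp⟩
  | cons a L ih =>
    obtain ⟨U, h1, h2, h3⟩ := ih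
    by_cases h : ∃ u ∈ U, Entails a u
    · exact ⟨U, fun q hq => List.mem_cons_of_mem _ (h1 q hq), by simpa using ⟨h, h2⟩, h3⟩
    · push Not at h
      refine ⟨a :: U.filter fun u => ¬ Entails u a, ?_, ?_, ?_⟩
      · intro q hq
        rcases List.mem_cons.1 hq with rfl | hq
        · exact List.mem_cons_self
        · exact List.mem_cons_of_mem _ (h1 q (List.mem_of_mem_filter hq))
      · intro d hd
        rcases List.mem_cons.1 hd with rfl | hd
        · exact ⟨d, List.mem_cons_self, Entails.refl _⟩
        · obtain ⟨q, hq, hdq⟩ := h2 d hd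
          by_cases hqa : Entails q a
          · exact ⟨a, List.mem_cons_self, hdq.trans hqa⟩
          · exact ⟨q, List.mem_cons_of_mem _ (List.mem_filter.2 ⟨hq, by simpa using hqa⟩), hdq⟩
      · refine List.pairwise_cons.2 ⟨fun q hq => ?_, h3.filter _⟩
        obtain ⟨hq, hqa⟩ := List.mem_filter.1 hq
        exact ⟨h q hq, by simpa using hqa⟩

theorem exists_termList [DecidableEq ρ] (U : List (CNF ρ)) : ∃ T, IsTermList U T := by
  classical
  have key : ∀ L : List (CNF ρ), ∃ T : List (CNF ρ), (∀ q ∈ T, q ∈ L) ∧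
      (∀ d ∈ L, ∃ q ∈ T, Equivalent d q) ∧ T.Pairwise fun q q' => ¬ Equivalent q q' := by
    intro L
    induction L with
    | nil => exact ⟨[], by simp, by simp, by simp⟩
    | cons a L ih =>
      obtain ⟨T, h1, h2, h3⟩ := ih
      by_cases h : ∃ u ∈ T, Equivalent a u
      · exact ⟨T, fun q hq => List.mem_cons_of_mem _ (h1 q hq), by simpa using ⟨h, h2⟩, h3⟩
      · push Not at h
        refine ⟨a :: T, ?_, ?_, List.pairwise_cons.2 ⟨h, h3⟩⟩
        · intro q hq
          rcases List.mem_cons.1 hq with rfl | hq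
          · exact List.mem_cons_self
          · exact List.mem_cons_of_mem _ (h1 q hq)
        · intro d hd
          rcases List.mem_cons.1 hd with rfl | hd
          · exact ⟨d, List.mem_cons_self, Entails.refl _, Entails.refl _⟩
          · obtain ⟨q, hq, hdq⟩ := h2 d hd
            exact ⟨q, List.mem_cons_of_mem _ hq, hdq⟩
  obtain ⟨T, h1, h2, h3⟩ := key
    (((Finset.univ : Finset (Finset (Fin U.length))).filter Finset.Nonempty).toList.map
      (conjunction U))
  refine ⟨T, fun q hq => ?_, fun s hs => h2 _ ?_, h3⟩
  · obtain ⟨s, hs, rfl⟩ := List.mem_map.1 (h1 q hq)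
    exact ⟨s, by simpa using hs, rfl⟩
  · exact List.mem_map.2 ⟨s, by simpa using hs, rfl⟩

/-- All the choices of the algorithm can be made. -/
theorem Implementation.nonempty [DecidableEq ρ] : Nonempty (Implementation ρ) := by
  classical
  choose simplify hs using exists_simplification (ρ := ρ)
  have hU : ∀ Q : CNF ρ, ∃ U, IsUnionCNF simplify Q U := by
    intro Q
    obtain ⟨𝒞, h1, h2⟩ := exists_splittings Q
    obtain ⟨U, h3, h4, h5⟩ := exists_maximal_list ((distribute 𝒞 Q).toList.map simplify)
    refine ⟨U, 𝒞, h1, h2, fun q hq => ?_, fun d hd => ?_, h5⟩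
    · obtain ⟨d, hd, rfl⟩ := List.mem_map.1 (h3 q hq)
      exact ⟨d, by simpa using hd, rfl⟩
    · obtain ⟨q, hq, hdq⟩ := h4 (simplify d) (List.mem_map.2 ⟨d, by simpa using hd, rfl⟩)
      exact ⟨q, hq, (hs d).1.1.trans hdq⟩
  choose union hunion using hU
  choose terms hterms using exists_termList (ρ := ρ)
  have pick : ∀ {α : Type _} [Nonempty α] (p : α → Prop), ∃ a, (∃ x, p x) → p a := by
    intro α _ p
    by_cases h : ∃ x, p x
    · exact ⟨h.choose, fun _ => h.choose_spec⟩
    · exact ⟨Classical.arbitrary α, fun h' => absurd h' h⟩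
  choose up hup using fun U : List (CNF ρ) => pick (IsUnionPartition U)
  choose cp hcp using fun Q : CNF ρ => pick (IsClausePartition Q)
  have hsep : ∀ Q : CNF ρ, ∃ a, (∃ x, IsSeparator Q x) → IsSeparator Q a := by
    intro Q
    by_cases h : ∃ x, IsSeparator Q x
    · exact ⟨h.choose, fun _ => h.choose_spec⟩
    · exact ⟨(fun _ => 0, fun _ _ => 0), fun h' => absurd h' h⟩
  choose sp hsp using hsep
  exact ⟨⟨simplify, hs, union, hunion, up, hup, terms, hterms, cp, hcp, sp, hsp, fun _ => 0⟩⟩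

end Existence

end LiftR

/-! The tests that select a rule mention only the query, never the domain size or the probabilities.
So, over nonempty domains, the tree of queries met in the recursion has the same shape for all
databases, except that a separator node has one child query repeated `n` times. Failure is therefore
a property of the query. Induction along the recursion proves a dichotomy (`Settles`): a query fails
on all databases, or returns its probability on all of them in time `O(n ^ k)` with a uniform
constant. The inductive step is `settled_step`.

Soundness: `Pr(Q)` is the expectation of the truth value of `Q` on a random set of ground atoms, and
atoms not occurring in `Q` integrate out. The two partition rules express independence of functions
of disjoint sets of atoms (`Pr_union_of_disjoint`, `Pr_of_or`). Inclusion/exclusion is the expansion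
of `1 - ∏ (1 - truth Q_i)` (`Pr_inclusion_exclusion`, `Pr_eq_sum_terms`). A separator splits the
relevant atoms into disjoint slices, one for each constant, and `Q` says the same about each slice
(`Pr_separator`).

Time: only the separator rule makes a number of calls depending on `n`, and it lowers the largest
arity by one, so each factor `n` is paid for by an arity (`Settles.prod`).

Termination (`ranked_induction`): partitions lose predicates and separators lose arity, so the sum
of the largest arity and the number of predicates drops. Inclusion/exclusion may keep this sum, but
it passes to a strictly stronger query. Since the added components subsume clauses of `Q`, no new
predicates and no longer clauses arise. Up to equivalence only finitely many such clauses exist, and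
the number of those not implied by the query drops. -/

namespace LiftR

variable {ρ : Type*}

/-! ## Random subsets of a finite set -/

section Expectation

variable {α : Type*} [DecidableEq α]

/-- The probability that a random subset of `A`, containing each `g ∈ A` independently with
probability `p g`, is `I`. -/
def weight (p : α → ℝ) (A I : Finset α) : ℝ := ∏ g ∈ A, if g ∈ I then p g else 1 - p g

/-- The expectation of `F` on a random subset of `A`. -/
def expectation (p : α → ℝ) (A : Finset α) (F : Finset α → ℝ) : ℝ :=
  ∑ I ∈ A.powerset, F I * weight p A I

theorem expectation_congr {p : α → ℝ} {A : Finset α} {F G : Finset α → ℝ}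
    (h : ∀ I ⊆ A, F I = G I) : expectation p A F = expectation p A G :=
  Finset.sum_congr rfl fun I hI => by rw [h I (Finset.mem_powerset.1 hI)]

/-- The product of `p g + (1 - p g) = 1` over `A`, multiplied out, is the sum of all weights. -/
theorem expectation_one (p : α → ℝ) (A : Finset α) : expectation p A (fun _ => 1) = 1 := by
  have h := Finset.prod_add p (fun g => 1 - p g) A
  simp only [add_sub_cancel, Finset.prod_const_one] at h
  refine Eq.trans ?_ h.symm
  refine Finset.sum_congr rfl fun I hI => ?_
  rw [Finset.mem_powerset] at hI
  rw [one_mul, weight, Finset.prod_ite, Finset.filter_mem_eq_inter,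
    Finset.inter_eq_right.2 hI, ← Finset.sdiff_eq_filter]

theorem expectation_sum {ι : Type*} (p : α → ℝ) (A : Finset α) (s : Finset ι)
    (F : ι → Finset α → ℝ) :
    expectation p A (fun I => ∑ i ∈ s, F i I) = ∑ i ∈ s, expectation p A (F i) := by
  simp only [expectation, Finset.sum_mul]
  exact Finset.sum_comm

theorem expectation_const_mul (p : α → ℝ) (A : Finset α) (c : ℝ) (F : Finset α → ℝ) :
    expectation p A (fun I => c * F I) = c * expectation p A F := by
  simp only [expectation, Finset.mul_sum, mul_assoc]

theorem expectation_one_sub (p : α → ℝ) (A : Finset α) (F : Finset α → ℝ) :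
    expectation p A (fun I => 1 - F I) = 1 - expectation p A F := by
  have h := expectation_one p A
  simp only [expectation, one_mul] at h
  simp only [expectation, sub_mul, Finset.sum_sub_distrib, one_mul, h]

theorem weight_union {p : α → ℝ} {A B I J : Finset α} (hAB : Disjoint A B) (hI : I ⊆ A)
    (hJ : J ⊆ B) : weight p (A ∪ B) (I ∪ J) = weight p A I * weight p B J := by
  rw [weight, Finset.prod_union hAB]
  congr 1 <;> refine Finset.prod_congr rfl fun g hg => ?_
  · have : g ∉ J := fun h => Finset.disjoint_left.1 hAB hg (hJ h)
    simp [this]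
  · have : g ∉ I := fun h => Finset.disjoint_left.1 hAB (hI h) hg
    simp [this]

/-- Functions of disjoint parts of a random set are independent. -/
theorem expectation_union {p : α → ℝ} {A B : Finset α} {F G : Finset α → ℝ}
    (hAB : Disjoint A B) (hF : ∀ I, F (I ∩ A) = F I) (hG : ∀ I, G (I ∩ B) = G I) :
    expectation p (A ∪ B) (fun I => F I * G I) = expectation p A F * expectation p B G := by
  rw [expectation, expectation, expectation, Finset.sum_mul_sum, ← Finset.sum_product']
  -- A subset of `A ∪ B` is the same as a pair of subsets of `A` and `B`, and its weight is the
  -- product of theirs.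
  refine Finset.sum_nbij' (fun I => (I ∩ A, I ∩ B)) (fun x => x.1 ∪ x.2) ?_ ?_ ?_ ?_ ?_
  · intro I _
    simp
  · rintro ⟨I, J⟩ h
    simp only [Finset.mem_product, Finset.mem_powerset] at h ⊢
    exact Finset.union_subset_union h.1 h.2
  · intro I hI
    rw [← Finset.inter_union_distrib_left]
    exact Finset.inter_eq_left.2 (Finset.mem_powerset.1 hI)
  · rintro ⟨I, J⟩ h
    simp only [Finset.mem_product, Finset.mem_powerset] at h
    have h1 : J ∩ A = ∅ := Finset.disjoint_iff_inter_eq_empty.1 (hAB.symm.mono_left h.2)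
    have h2 : I ∩ B = ∅ := Finset.disjoint_iff_inter_eq_empty.1 (hAB.mono_left h.1)
    simp [Finset.union_inter_distrib_right, h1, h2, Finset.inter_eq_left.2 h.1,
      Finset.inter_eq_left.2 h.2]
  · intro I hI
    have h : (I ∩ A) ∪ (I ∩ B) = I := by
      rw [← Finset.inter_union_distrib_left]
      exact Finset.inter_eq_left.2 (Finset.mem_powerset.1 hI)
    have hw := weight_union (p := p) hAB (Finset.inter_subset_right (s₁ := I))
      (Finset.inter_subset_right (s₁ := I))
    rw [h] at hw
    simp only [hF, hG, hw]
    ring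

/-- Elements outside `A` integrate out, by independence from the constant `1` on `B \ A`. Queries
with different ground atoms can thus be compared over one common set of atoms. -/
theorem expectation_of_subset {p : α → ℝ} {A B : Finset α} {F : Finset α → ℝ} (hAB : A ⊆ B)
    (hF : ∀ I, F (I ∩ A) = F I) : expectation p B F = expectation p A F := by
  have h := expectation_union (p := p) (B := B \ A) (G := fun _ => 1) Finset.disjoint_sdiff hF
    fun _ => rfl
  simpa only [Finset.union_sdiff_of_subset hAB, mul_one, expectation_one] using h

theorem expectation_biUnion {ι : Type*} [DecidableEq ι] {p : α → ℝ} {s : Finset ι}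
    {A : ι → Finset α} {F : ι → Finset α → ℝ} (hA : ∀ i ∈ s, ∀ j ∈ s, i ≠ j → Disjoint (A i) (A j))
    (hF : ∀ i ∈ s, ∀ I, F i (I ∩ A i) = F i I) :
    expectation p (s.biUnion A) (fun I => ∏ i ∈ s, F i I) = ∏ i ∈ s, expectation p (A i) (F i) := by
  induction s using Finset.induction_on with
  | empty => simpa using expectation_one p ∅
  | insert i s hi ih =>
    simp only [Finset.prod_insert hi, Finset.biUnion_insert]
    rw [expectation_union, ih]
    · exact fun j hj k hk => hA j (Finset.mem_insert_of_mem hj) k (Finset.mem_insert_of_mem hk)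
    · exact fun j hj => hF j (Finset.mem_insert_of_mem hj)
    · rw [Finset.disjoint_biUnion_right]
      intro j hj
      exact hA i (Finset.mem_insert_self _ _) j (Finset.mem_insert_of_mem hj)
        (fun h => hi (h ▸ hj))
    · exact hF i (Finset.mem_insert_self _ _)
    · intro I
      refine Finset.prod_congr rfl fun j hj => ?_
      have hj' := hF j (Finset.mem_insert_of_mem hj)
      rw [← hj', Finset.inter_assoc,
        Finset.inter_eq_right.2 (Finset.subset_biUnion_of_mem A hj), hj']

theorem expectation_image {β : Type*} [DecidableEq β] {p : α → ℝ} {f : β → α} {A : Finset β}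
    (hf : Set.InjOn f A) (F : Finset α → ℝ) :
    expectation p (A.image f) F = expectation (p ∘ f) A (fun I => F (I.image f)) := by
  rw [expectation, Finset.powerset_image, Finset.sum_image]
  · refine Finset.sum_congr rfl fun I hI => ?_
    rw [Finset.mem_powerset] at hI
    rw [weight, Finset.prod_image hf]
    congr 1
    refine Finset.prod_congr rfl fun g hg => ?_
    have : f g ∈ I.image f ↔ g ∈ I := by
      rw [Finset.mem_image]
      exact ⟨fun ⟨x, hx, h⟩ => hf (hI hx) hg h ▸ hx, fun h => ⟨g, h, rfl⟩⟩
    simp only [this, Function.comp_apply]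
  · intro I hI J hJ h
    simp only [Finset.coe_powerset, Set.mem_preimage, Set.mem_powerset_iff,
      Finset.coe_subset] at hI hJ
    have h' := congrArg (fun s : Finset α => (s : Set α)) h
    simp only [Finset.coe_image] at h'
    exact_mod_cast (hf.image_eq_image_iff (Finset.coe_subset.2 hI) (Finset.coe_subset.2 hJ)).1 h'

end Expectation

/-! ## Semantics of queries -/

theorem Clause.holds_congr {D : Type*} {I J : World ρ D} {C : Clause ρ}
    (h : ∀ l ∈ C, ∀ v : ℕ → D, I l.rel (l.args.map v) ↔ J l.rel (l.args.map v)) :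
    C.Holds I ↔ C.Holds J := by
  refine forall_congr' fun v => exists_congr fun l => and_congr_right fun hl => ?_
  simp only [Literal.Holds, h l hl v]

theorem CNF.holds_congr {D : Type*} {I J : World ρ D} {Q : CNF ρ}
    (h : ∀ C ∈ Q, ∀ l ∈ C, ∀ v : ℕ → D, I l.rel (l.args.map v) ↔ J l.rel (l.args.map v)) :
    Q.Holds I ↔ Q.Holds J :=
  forall_congr' fun C => forall_congr' fun hC => Clause.holds_congr (h C hC)

theorem Equivalent.symm {Q Q' : CNF ρ} (h : Equivalent Q Q') : Equivalent Q' Q := ⟨h.2, h.1⟩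

theorem not_holds_of_empty_mem {D : Type*} [Nonempty D] {I : World ρ D} {Q : CNF ρ} (h : ∅ ∈ Q) :
    ¬ Q.Holds I := fun hQ => by
  obtain ⟨l, hl, -⟩ := hQ ∅ h fun _ => Classical.arbitrary D
  simp at hl

theorem holds_singleton {D : Type*} {I : World ρ D} {C : Clause ρ} :
    CNF.Holds I {C} ↔ C.Holds I := by
  simp [CNF.Holds]

theorem Entails.holds {Q Q' : CNF ρ} (h : Entails Q Q') {n : ℕ} (hn : 1 ≤ n) {I : World ρ (Fin n)}
    (hQ : Q.Holds I) : Q'.Holds I :=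
  have : Nonempty (Fin n) := ⟨⟨0, hn⟩⟩
  h (Fin n) I hQ

theorem Literal.symbol_rename (σ : ℕ → ℕ) (l : Literal ρ) : (l.rename σ).symbol = l.symbol := by
  simp [Literal.symbol, Literal.rename]

/-- The database `I` restricted to the tuples with `a` at the positions `pos`. -/
def World.restrict {D : Type*} (I : World ρ D) (pos : ρ → ℕ → ℕ) (a : D) : World ρ D :=
  fun R t => I R (t.insertIdx (pos R (t.length + 1)) a)

theorem map_eq_insertIdx_eraseIdx {D : Type*} {L : List ℕ} {i x : ℕ} (h : L[i]? = some x)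
    (v : ℕ → D) :
    L.map v = ((L.eraseIdx i).map v).insertIdx i (v x) := by
  obtain ⟨hi, rfl⟩ := List.getElem?_eq_some_iff.1 h
  rw [← List.map_insertIdx, List.insertIdx_eraseIdx_getElem hi]

theorem IsSeparator.lt_length {Q : CNF ρ} {sep : (Clause ρ → ℕ) × (ρ → ℕ → ℕ)}
    (h : IsSeparator Q sep) {C : Clause ρ} (hC : C ∈ Q) {l : Literal ρ} (hl : l ∈ C) :
    sep.2 l.rel l.args.length < l.args.length :=
  (List.getElem?_eq_some_iff.1 (h C hC l hl)).1

theorem IsSeparator.holds_literal {D : Type*} {I : World ρ D} {l : Literal ρ} {pos : ρ → ℕ → ℕ}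
    {x : ℕ} (hx : l.args[pos l.rel l.args.length]? = some x) (v : ℕ → D) :
    l.Holds I v ↔ Literal.Holds (World.restrict I pos (v x)) v
      ⟨l.pos, l.rel, l.args.eraseIdx (pos l.rel l.args.length)⟩ := by
  have hlt := (List.getElem?_eq_some_iff.1 hx).1
  have hlen : ((l.args.eraseIdx (pos l.rel l.args.length)).map v).length + 1 = l.args.length := by
    rw [List.length_map, List.length_eraseIdx_of_lt hlt]
    omega
  simp only [Literal.Holds, World.restrict, hlen]
  rw [← map_eq_insertIdx_eraseIdx hx]

/-! ### Truth values as functions of a set of ground atoms. -/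

section

variable {n : ℕ}

open Classical in
/-- The truth value, `0` or `1`, of `Q` in the world with the set `I` of true ground atoms. -/
noncomputable def truth (Q : CNF ρ) (I : Finset (ρ × List (Fin n))) : ℝ :=
  if Q.Holds (fun R t => (R, t) ∈ I) then 1 else 0

theorem truth_eq_one {Q : CNF ρ} {I : Finset (ρ × List (Fin n))}
    (h : Q.Holds (fun R t => (R, t) ∈ I)) : truth Q I = 1 := if_pos h

theorem truth_eq_zero {Q : CNF ρ} {I : Finset (ρ × List (Fin n))}
    (h : ¬ Q.Holds (fun R t => (R, t) ∈ I)) : truth Q I = 0 := if_neg h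

theorem truth_eq_truth {Q Q' : CNF ρ} {I J : Finset (ρ × List (Fin n))}
    (h : Q.Holds (fun R t => (R, t) ∈ I) ↔ Q'.Holds (fun R t => (R, t) ∈ J)) :
    truth Q I = truth Q' J := by
  classical
  exact if_congr h rfl rfl

def PDB.atom (P : PDB ρ n) (g : ρ × List (Fin n)) : ℝ := P.prob g.1 g.2

end

section

variable [DecidableEq ρ]

theorem CNF.holds_union {D : Type*} {I : World ρ D} {Q Q' : CNF ρ} :
    (Q ∪ Q').Holds I ↔ Q.Holds I ∧ Q'.Holds I := by
  simp only [CNF.Holds, Finset.mem_union, or_imp, forall_and]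

/-- The shift moves the variables of `E` beyond those of `C`, so assignments falsifying `C` and `E`
separately glue to one falsifying the union. -/
theorem Clause.holds_union_shift {D : Type*} {I : World ρ D} (C E : Clause ρ) :
    Clause.Holds I (C ∪ E.rename (· + (C.vars.sup id + 1))) ↔ C.Holds I ∨ E.Holds I := by
  constructor
  · intro h
    by_contra hno
    simp only [Clause.Holds, not_or, not_forall, not_exists, not_and] at hno
    obtain ⟨⟨v, hv⟩, w, hw⟩ := hno
    obtain ⟨l, hl, hl'⟩ := h fun x =>
      if x ≤ C.vars.sup id then v x else w (x - (C.vars.sup id + 1))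
    rcases Finset.mem_union.1 hl with hl | hl
    · refine hv l hl ?_
      rwa [Literal.Holds, List.map_congr_left (g := v)] at hl'
      intro x hx
      have : x ≤ C.vars.sup id := Finset.le_sup (f := id)
        (Finset.mem_biUnion.2 ⟨l, hl, List.mem_toFinset.2 hx⟩)
      simp [this]
    · obtain ⟨l, hlE, rfl⟩ := Finset.mem_image.1 hl
      refine hw l hlE ?_
      simp only [Literal.Holds, Literal.rename, List.map_map] at hl'
      rwa [List.map_congr_left (g := w)] at hl'
      intro x _
      have : ¬ x + (C.vars.sup id + 1) ≤ C.vars.sup id := by omega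
      simp [this]
  · rintro (h | h)
    · exact h.mono Finset.subset_union_left
    · exact (h.rename _).mono Finset.subset_union_right

theorem CNF.holds_or {D : Type*} {I : World ρ D} {q r : CNF ρ} :
    (q.or r).Holds I ↔ q.Holds I ∨ r.Holds I := by
  simp only [CNF.Holds, CNF.or, Finset.mem_image₂]
  constructor
  · intro h
    by_contra hno
    push Not at hno
    obtain ⟨⟨C, hC, hC'⟩, E, hE, hE'⟩ := hno
    rcases (Clause.holds_union_shift C E).1 (h _ ⟨C, hC, E, hE, rfl⟩) with h | h
    · exact hC' h
    · exact hE' h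
  · rintro h _ ⟨C, hC, E, hE, rfl⟩
    exact (Clause.holds_union_shift C E).2 (h.imp (· C hC) (· E hE))

theorem holds_disjunction {D : Type*} [Nonempty D] {I : World ρ D} {U : List (CNF ρ)} :
    (disjunction U).Holds I ↔ ∃ q ∈ U, q.Holds I := by
  induction U with
  | nil =>
    simp only [List.not_mem_nil, false_and, exists_false, iff_false]
    exact not_holds_of_empty_mem (Finset.mem_singleton_self _)
  | cons q U ih =>
    rw [show disjunction (q :: U) = q.or (disjunction U) from rfl, CNF.holds_or, ih]
    simp

theorem holds_conjunction {D : Type*} {I : World ρ D} {U : List (CNF ρ)}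
    {s : Finset (Fin U.length)} : (conjunction U s).Holds I ↔ ∀ i ∈ s, (U.get i).Holds I := by
  simp only [CNF.Holds, conjunction, Finset.mem_biUnion]
  exact ⟨fun h i hi C hC => h C ⟨i, hi, hC⟩, fun h C ⟨i, hi, hC⟩ => h i hi C hC⟩

/-! ## Probabilities of queries -/

variable {n : ℕ}

theorem mem_groundAtoms {Q : CNF ρ} {g : ρ × List (Fin n)} :
    g ∈ groundAtoms n Q ↔ (g.1, g.2.length) ∈ Q.symbols := by
  obtain ⟨R, t⟩ := g
  simp only [groundAtoms, Finset.mem_biUnion, Finset.mem_image, Finset.mem_univ, true_and,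
    Prod.mk.injEq]
  constructor
  · rintro ⟨⟨R', k⟩, h, f, rfl, rfl⟩
    simpa using h
  · intro h
    exact ⟨(R, t.length), h, t.get, rfl, List.ofFn_get t⟩

theorem mem_symbols {Q : CNF ρ} {s : ρ × ℕ} :
    s ∈ Q.symbols ↔ ∃ C ∈ Q, ∃ l ∈ C, l.symbol = s := by
  simp [CNF.symbols]

theorem symbols_union (Q Q' : CNF ρ) : (Q ∪ Q').symbols = Q.symbols ∪ Q'.symbols :=
  Finset.union_biUnion

theorem symbol_mem_symbols {Q : CNF ρ} {C : Clause ρ} {l : Literal ρ} (hC : C ∈ Q) (hl : l ∈ C) :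
    l.symbol ∈ Q.symbols := mem_symbols.2 ⟨C, hC, l, hl, rfl⟩

theorem holds_congr_groundAtoms {Q : CNF ρ} {I J : World ρ (Fin n)}
    (h : ∀ g ∈ groundAtoms n Q, I g.1 g.2 ↔ J g.1 g.2) : Q.Holds I ↔ Q.Holds J :=
  CNF.holds_congr fun C hC l hl v => h (l.rel, l.args.map v) <| mem_groundAtoms.2 <| by
    simpa [Literal.symbol] using symbol_mem_symbols hC hl

theorem truth_congr {Q : CNF ρ} {I J : Finset (ρ × List (Fin n))}
    (h : ∀ g ∈ groundAtoms n Q, g ∈ I ↔ g ∈ J) : truth Q I = truth Q J :=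
  truth_eq_truth (holds_congr_groundAtoms fun g hg => h g hg)

theorem truth_inter (Q : CNF ρ) {A : Finset (ρ × List (Fin n))} (hA : groundAtoms n Q ⊆ A)
    (I : Finset (ρ × List (Fin n))) : truth Q (I ∩ A) = truth Q I :=
  truth_congr fun g hg => by simp [hA hg]

theorem Pr_eq_expectation (P : PDB ρ n) (Q : CNF ρ) :
    Pr P Q = expectation P.atom (groundAtoms n Q) (truth Q) := by
  unfold Pr expectation
  refine Finset.sum_congr rfl fun I _ => ?_
  unfold truth weight PDB.atom
  by_cases h : CNF.Holds (fun R t => (R, t) ∈ I) Q <;> simp [h]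

theorem Pr_eq_expectation_of_subset (P : PDB ρ n) {Q : CNF ρ} {A : Finset (ρ × List (Fin n))}
    (hA : groundAtoms n Q ⊆ A) : Pr P Q = expectation P.atom A (truth Q) := by
  rw [Pr_eq_expectation, expectation_of_subset hA (truth_inter Q subset_rfl)]

/-- Equivalent queries may have different predicates, so both expectations are first taken over the
union of their ground atoms. Equivalence concerns nonempty domains, hence `1 ≤ n`. -/
theorem Pr_congr (hn : 1 ≤ n) (P : PDB ρ n) {Q Q' : CNF ρ} (h : Equivalent Q Q') :
    Pr P Q = Pr P Q' := by
  rw [Pr_eq_expectation_of_subset P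
      (Finset.subset_union_left (s₂ := groundAtoms n Q')),
    Pr_eq_expectation_of_subset P (Finset.subset_union_right (s₁ := groundAtoms n Q))]
  exact expectation_congr fun I _ => truth_eq_truth ⟨h.1.holds hn, h.2.holds hn⟩

theorem groundAtoms_disjoint {Q Q' : CNF ρ} (h : Disjoint Q.symbols Q'.symbols) :
    Disjoint (groundAtoms n Q) (groundAtoms n Q') :=
  Finset.disjoint_left.2 fun _ hg hg' =>
    Finset.disjoint_left.1 h (mem_groundAtoms.1 hg) (mem_groundAtoms.1 hg')

theorem Pr_empty (P : PDB ρ n) : Pr P (∅ : CNF ρ) = 1 := by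
  rw [Pr_eq_expectation, ← expectation_one P.atom (groundAtoms n ∅)]
  exact expectation_congr fun I _ => truth_eq_one (by simp [CNF.Holds])

theorem Pr_of_empty_mem (hn : 1 ≤ n) (P : PDB ρ n) {Q : CNF ρ} (h : ∅ ∈ Q) : Pr P Q = 0 := by
  have : Nonempty (Fin n) := ⟨⟨0, hn⟩⟩
  rw [Pr_eq_expectation, expectation]
  exact Finset.sum_eq_zero fun I _ => by
    rw [truth_eq_zero (not_holds_of_empty_mem h), zero_mul]

theorem Pr_literal (hn : 1 ≤ n) (P : PDB ρ n) {l : Literal ρ} (hl : l.args = []) :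
    Pr P {{l}} = P.literal l := by
  have hA : groundAtoms n ({{l}} : CNF ρ) = {(l.rel, [])} := by
    ext ⟨R, t⟩
    simp only [mem_groundAtoms, CNF.symbols, Finset.singleton_biUnion, Finset.image_singleton,
      Finset.mem_singleton, Literal.symbol, hl, List.length_nil, Prod.mk.injEq,
      List.length_eq_zero_iff]
  have hh : ∀ I : World ρ (Fin n), CNF.Holds I {{l}} ↔
      if l.pos then I l.rel [] else ¬ I l.rel [] := by
    intro I
    rw [holds_singleton]
    simp only [Clause.Holds, Finset.mem_singleton, exists_eq_left, Literal.Holds, hl, List.map_nil]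
    exact ⟨fun h => h fun _ => ⟨0, hn⟩, fun h _ => h⟩
  rw [Pr_eq_expectation, hA, expectation,
    show ({(l.rel, [])} : Finset (ρ × List (Fin n))).powerset = {∅, {(l.rel, [])}} from rfl,
    Finset.sum_pair (Finset.singleton_ne_empty _).symm]
  unfold truth
  simp only [hh, weight, PDB.atom, PDB.literal]
  cases l.pos <;> simp

theorem Pr_union_of_disjoint (P : PDB ρ n) {Q Q' : CNF ρ} (h : Disjoint Q.symbols Q'.symbols) :
    Pr P (Q ∪ Q') = Pr P Q * Pr P Q' := by
  have hA : groundAtoms n (Q ∪ Q') ⊆ groundAtoms n Q ∪ groundAtoms n Q' := by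
    intro g
    simp only [mem_groundAtoms, Finset.mem_union, symbols_union]
    exact id
  rw [Pr_eq_expectation_of_subset P hA, Pr_eq_expectation P Q, Pr_eq_expectation P Q',
    ← expectation_union (groundAtoms_disjoint h) (truth_inter Q subset_rfl)
      (truth_inter Q' subset_rfl)]
  refine expectation_congr fun I _ => ?_
  by_cases h1 : CNF.Holds (fun R t => (R, t) ∈ I) Q <;>
    by_cases h2 : CNF.Holds (fun R t => (R, t) ∈ I) Q' <;>
      simp [truth, CNF.holds_union, h1, h2]

/-- The truth values satisfy `1 - truth Q = (1 - truth Q₁) * (1 - truth Q₂)`, and the factors are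
independent. The predicates of `Q` need not be those of `Q₁` and `Q₂`, so everything is computed
over the atoms of all three. -/
theorem Pr_of_or (P : PDB ρ n) {Q Q₁ Q₂ : CNF ρ} (h : Disjoint Q₁.symbols Q₂.symbols)
    (hQ : ∀ I : World ρ (Fin n), Q.Holds I ↔ Q₁.Holds I ∨ Q₂.Holds I) :
    Pr P Q = 1 - (1 - Pr P Q₁) * (1 - Pr P Q₂) := by
  have hA := Finset.subset_union_left (s₁ := groundAtoms n Q₁ ∪ groundAtoms n Q₂)
    (s₂ := groundAtoms n Q)
  have key : expectation P.atom (groundAtoms n Q₁ ∪ groundAtoms n Q₂ ∪ groundAtoms n Q)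
      (fun I => (1 - truth Q₁ I) * (1 - truth Q₂ I)) = (1 - Pr P Q₁) * (1 - Pr P Q₂) := by
    have h1 := truth_inter (n := n) Q₁ subset_rfl
    have h2 := truth_inter (n := n) Q₂ subset_rfl
    rw [expectation_of_subset hA, expectation_union (groundAtoms_disjoint h), expectation_one_sub,
      expectation_one_sub, ← Pr_eq_expectation, ← Pr_eq_expectation]
    · simp [h1]
    · simp [h2]
    · intro I
      rw [truth_inter Q₁ Finset.subset_union_left, truth_inter Q₂ Finset.subset_union_right]
  rw [← key, ← expectation_one_sub, Pr_eq_expectation_of_subset P Finset.subset_union_right]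
  refine expectation_congr fun I _ => ?_
  by_cases h1 : CNF.Holds (fun R t => (R, t) ∈ I) Q₁ <;>
    by_cases h2 : CNF.Holds (fun R t => (R, t) ∈ I) Q₂ <;> simp [truth, hQ, h1, h2]

/-- Pointwise, `1 - truth Q = ∏ (1 - truth Q_i)`, and a product of truth values over `s` is the
truth value of the conjunction over `s`. Multiply out and take expectations over one set of atoms
`A` that serves all conjunctions. -/
theorem Pr_inclusion_exclusion (P : PDB ρ n) {Q : CNF ρ} {U : List (CNF ρ)}
    (hQ : ∀ I : World ρ (Fin n), Q.Holds I ↔ ∃ q ∈ U, q.Holds I) :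
    Pr P Q = ∑ s : Finset (Fin U.length),
      if s.Nonempty then (-1) ^ (s.card + 1) * Pr P (conjunction U s) else 0 := by
  classical
  let A := groundAtoms n Q ∪ Finset.univ.biUnion fun s => groundAtoms n (conjunction U s)
  have hA : ∀ s, groundAtoms n (conjunction U s) ⊆ A := fun s =>
    (Finset.subset_biUnion_of_mem (fun s => groundAtoms n (conjunction U s))
      (Finset.mem_univ s)).trans Finset.subset_union_right
  have h1 : ∀ s : Finset (Fin U.length),
      (if s.Nonempty then (-1) ^ (s.card + 1) * Pr P (conjunction U s) else 0) =
        expectation P.atom A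
          fun I => (if s.Nonempty then (-1) ^ (s.card + 1) else 0) * truth (conjunction U s) I := by
    intro s
    rw [expectation_const_mul, ← Pr_eq_expectation_of_subset P (hA s)]
    split_ifs <;> simp
  rw [Finset.sum_congr rfl fun s _ => h1 s, ← expectation_sum,
    Pr_eq_expectation_of_subset P Finset.subset_union_left]
  refine expectation_congr fun I _ => ?_
  have hprod : ∀ s, truth (conjunction U s) I = ∏ i ∈ s, truth (U.get i) I := by
    intro s
    by_cases h : ∀ i ∈ s, (U.get i).Holds (fun R t => (R, t) ∈ I)
    · rw [truth_eq_one (holds_conjunction.2 h),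
        Finset.prod_eq_one fun i hi => truth_eq_one (h i hi)]
    · rw [truth_eq_zero (mt holds_conjunction.1 h)]
      push Not at h
      obtain ⟨i, hi, hi'⟩ := h
      exact (Finset.prod_eq_zero hi (truth_eq_zero hi')).symm
  have h2 := Finset.prod_one_add (f := fun i => - truth (U.get i) I)
    (Finset.univ : Finset (Fin U.length))
  have h3 : ∏ i : Fin U.length, (1 - truth (U.get i) I) = 1 - truth Q I := by
    by_cases h : CNF.Holds (fun R t => (R, t) ∈ I) Q
    · obtain ⟨q, hq, hqI⟩ := (hQ _).1 h
      obtain ⟨i, rfl⟩ := List.get_of_mem hq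
      rw [Finset.prod_eq_zero (Finset.mem_univ i)]
      · simp [truth, h]
      · rw [truth_eq_one hqI, sub_self]
    · rw [Finset.prod_eq_one]
      · simp [truth, h]
      · intro i _
        rw [truth_eq_zero fun hi => h ((hQ _).2 ⟨_, List.get_mem U i, hi⟩), sub_zero]
  simp only [← sub_eq_add_neg, h3, Finset.powerset_univ, Finset.prod_neg, ← hprod] at h2
  -- The term for `s = ∅` is the `1` in `1 - truth Q`; cancelling it leaves the sum over nonempty
  -- `s`.
  rw [← Finset.add_sum_erase _ _ (Finset.mem_univ ∅)] at h2 ⊢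
  have h4 : truth (conjunction U ∅) I = 1 := truth_eq_one (by simp [CNF.Holds, conjunction])
  rw [Finset.card_empty, pow_zero, one_mul, h4, sub_eq_add_neg, add_right_inj] at h2
  rw [if_neg Finset.not_nonempty_empty, zero_mul, zero_add, ← neg_neg (truth Q I), h2,
    ← Finset.sum_neg_distrib]
  refine Finset.sum_congr rfl fun s hs => ?_
  rw [if_pos (Finset.nonempty_iff_ne_empty.2 (Finset.ne_of_mem_erase hs))]
  ring

/-- The inclusion/exclusion formula with equivalent terms collected. -/
theorem Pr_eq_sum_terms (hn : 1 ≤ n) (P : PDB ρ n) {Q : CNF ρ} {U T : List (CNF ρ)}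
    (hQ : ∀ I : World ρ (Fin n), Q.Holds I ↔ ∃ q ∈ U, q.Holds I) (hT : IsTermList U T) :
    Pr P Q = (T.map fun q => coefficient U q * Pr P q).sum := by
  classical
  have : Std.Symm fun q q' : CNF ρ => ¬ Equivalent q q' := ⟨fun _ _ h h' => h h'.symm⟩
  have hnd : T.Nodup := hT.2.2.imp fun {a b} h => by
    rintro rfl
    exact h ⟨Entails.refl a, Entails.refl a⟩
  rw [Pr_inclusion_exclusion P hQ, ← List.sum_toFinset _ hnd]
  simp only [coefficient, Int.cast_sum, Finset.sum_mul]
  -- With the sums exchanged, each nonempty `s` contributes to exactly one representative, because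
  -- those in `T` are pairwise inequivalent.
  rw [Finset.sum_comm]
  refine Finset.sum_congr rfl fun s _ => ?_
  by_cases hs : s.Nonempty
  · obtain ⟨q, hq, hsq⟩ := hT.2.1 s hs
    rw [Finset.sum_eq_single_of_mem q (List.mem_toFinset.2 hq)]
    · simp [hs, hsq, Pr_congr hn P hsq]
    · intro q' hq' hne
      have : ¬ Equivalent (conjunction U s) q' := fun h =>
        hT.2.2.forall hq (List.mem_toFinset.1 hq') hne.symm
          ⟨hsq.2.trans h.1, h.2.trans hsq.1⟩
      simp [this]
  · simp [hs]

/-! ### Separators -/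

/-- Clauses are closed separately, so the values of their different separator variables may be fixed
to one common `a`. Rankedness ensures that the separator variable occurs only once in each atom. -/
theorem IsSeparator.holds_iff {D : Type*} {I : World ρ D} {Q : CNF ρ} (hQ : Q.Ranked)
    {sep : (Clause ρ → ℕ) × (ρ → ℕ → ℕ)} (h : IsSeparator Q sep) :
    Q.Holds I ↔ ∀ a, (Q.instantiate sep.2).Holds (I.restrict sep.2 a) := by
  simp only [CNF.Holds, CNF.instantiate, Finset.forall_mem_image]
  rw [forall_comm]
  refine forall_congr' fun C => ?_
  rw [forall_comm]
  refine forall_congr' fun hC => ?_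
  simp only [Clause.Holds, Finset.exists_mem_image]
  constructor
  · intro hI a v
    obtain ⟨l, hl, hlI⟩ := hI (Function.update v (sep.1 C) a)
    refine ⟨l, hl, ?_⟩
    have hx := h C hC l hl
    rw [IsSeparator.holds_literal hx, Function.update_self] at hlI
    rw [Literal.Holds] at hlI ⊢
    rwa [List.map_congr_left (g := v)] at hlI
    intro y hy
    -- Arguments of a ranked literal are distinct, so the separator variable is gone once its
    -- position is erased, and overwriting its value changes nothing.
    refine Function.update_of_ne ?_ _ _
    rintro rfl
    have hnd : l.args.Nodup := (hQ C hC l hl).imp fun h => h.ne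
    obtain ⟨i, hi, hiy⟩ := List.mem_eraseIdx_iff_getElem?.1 hy
    exact hi ((List.getElem?_inj (List.getElem?_eq_some_iff.1 hiy).1 hnd).1 (hiy.trans hx.symm))
  · intro hI v
    obtain ⟨l, hl, hlI⟩ := hI (v (sep.1 C)) v
    exact ⟨l, hl, (IsSeparator.holds_literal (h C hC l hl) v).2 hlI⟩

theorem IsSeparator.symbols_instantiate {Q : CNF ρ} {sep : (Clause ρ → ℕ) × (ρ → ℕ → ℕ)}
    (h : IsSeparator Q sep) {R : ρ} {k : ℕ} (hk : (R, k) ∈ (Q.instantiate sep.2).symbols) :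
    (R, k + 1) ∈ Q.symbols ∧ sep.2 R (k + 1) < k + 1 := by
  simp only [CNF.instantiate, mem_symbols, Finset.exists_mem_image] at hk
  obtain ⟨C, hC, l, hl, hs⟩ := hk
  have hlt := h.lt_length hC hl
  simp only [Literal.symbol, List.length_eraseIdx_of_lt hlt, Prod.mk.injEq] at hs
  obtain ⟨rfl, rfl⟩ := hs
  rw [Nat.sub_add_cancel (by omega)]
  exact ⟨symbol_mem_symbols hC hl, hlt⟩

/-- The atoms with `a` at the separator position form a slice. Slices of different constants are
disjoint since the position depends only on the predicate, so the instances for different `a` are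
independent. Each slice is a copy of the ground atoms of the instantiated query. -/
theorem Pr_separator (P : PDB ρ n) {Q : CNF ρ} (hQ : Q.Ranked)
    {sep : (Clause ρ → ℕ) × (ρ → ℕ → ℕ)} (h : IsSeparator Q sep) :
    Pr P Q = ∏ a : Fin n, Pr (P.restrict sep.2 a) (Q.instantiate sep.2) := by
  let f : Fin n → ρ × List (Fin n) → ρ × List (Fin n) := fun a g =>
    (g.1, g.2.insertIdx (sep.2 g.1 (g.2.length + 1)) a)
  let B := groundAtoms n (Q.instantiate sep.2)
  have hB : ∀ g ∈ B, (g.1, g.2.length + 1) ∈ Q.symbols ∧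
      sep.2 g.1 (g.2.length + 1) ≤ g.2.length := fun g hg => by
    obtain ⟨h1, h2⟩ := h.symbols_instantiate (mem_groundAtoms.1 hg)
    exact ⟨h1, Nat.lt_succ_iff.1 h2⟩
  -- Reading the separator position recovers the constant, and erasing it recovers the shorter
  -- tuple. This gives both injectivity on each slice and disjointness of the slices.
  have hinj : ∀ a b, ∀ g ∈ B, ∀ g' ∈ B, f a g = f b g' → a = b ∧ g = g' := by
    rintro a b ⟨R, t⟩ hg ⟨R', t'⟩ hg' heq
    have h1 := (hB _ hg).2
    have h2 := (hB _ hg').2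
    simp only [f, Prod.mk.injEq] at heq h1 h2
    obtain ⟨rfl, heq⟩ := heq
    have hlen : t.length = t'.length := by
      have := congrArg List.length heq
      rw [List.length_insertIdx_of_le_length h1, List.length_insertIdx_of_le_length h2] at this
      omega
    rw [← hlen] at heq
    have ha := congrArg (·[sep.2 R (t.length + 1)]?) heq
    have ht := congrArg (·.eraseIdx (sep.2 R (t.length + 1))) heq
    simp only [List.eraseIdx_insertIdx_self] at ht
    simp only [List.getElem?_insertIdx_self, ← hlen, h1, if_true, Option.some.injEq] at ha
    exact ⟨ha, by rw [ht]⟩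
  have hinjOn : ∀ a, Set.InjOn (f a) B := fun a g hg g' hg' heq => (hinj a a g hg g' hg' heq).2
  have hsub : (Finset.univ.biUnion fun a => B.image (f a)) ⊆ groundAtoms n Q := by
    intro g' hg'
    obtain ⟨a, -, hga⟩ := Finset.mem_biUnion.1 hg'
    obtain ⟨g, hg, rfl⟩ := Finset.mem_image.1 hga
    rw [mem_groundAtoms]
    simp only [f, List.length_insertIdx_of_le_length (hB g hg).2]
    exact (hB g hg).1
  -- The truth value of the instantiated query on the slice of `I` at `a`.
  let F : Fin n → Finset (ρ × List (Fin n)) → ℝ := fun a I =>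
    truth (Q.instantiate sep.2) (B.filter fun g => f a g ∈ I)
  have hF : ∀ a I, F a (I ∩ B.image (f a)) = F a I := fun a I =>
    truth_congr fun g hg => by
      simp only [Finset.mem_filter, Finset.mem_inter]
      exact ⟨fun h => ⟨h.1, h.2.1⟩, fun h => ⟨h.1, h.2, Finset.mem_image_of_mem _ h.1⟩⟩
  have hprod : ∀ I, truth Q I = ∏ a, F a I := by
    intro I
    have hr : ∀ a, CNF.Holds (World.restrict (fun R t => (R, t) ∈ I) sep.2 a)
        (Q.instantiate sep.2) ↔ CNF.Holds (fun R t => (R, t) ∈ B.filter fun g => f a g ∈ I)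
        (Q.instantiate sep.2) := fun a => holds_congr_groundAtoms fun g hg => by
      simp only [Finset.mem_filter, World.restrict, f]
      exact ⟨fun h => ⟨hg, h⟩, fun h => h.2⟩
    by_cases hI : CNF.Holds (fun R t => (R, t) ∈ I) Q
    · rw [truth_eq_one hI, Finset.prod_eq_one fun a _ =>
        truth_eq_one ((hr a).1 ((h.holds_iff hQ).1 hI a))]
    · rw [truth_eq_zero hI]
      rw [h.holds_iff hQ] at hI
      push Not at hI
      obtain ⟨a, ha⟩ := hI
      exact (Finset.prod_eq_zero (Finset.mem_univ a) (truth_eq_zero (mt (hr a).2 ha))).symm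
  have hFU : ∀ I, (∏ a, F a (I ∩ Finset.univ.biUnion fun a => B.image (f a))) = ∏ a, F a I := by
    intro I
    refine Finset.prod_congr rfl fun a _ => ?_
    rw [← hF, Finset.inter_assoc, Finset.inter_eq_right.2
      (Finset.subset_biUnion_of_mem (fun a => B.image (f a)) (Finset.mem_univ a)), hF]
  rw [Pr_eq_expectation, expectation_congr fun I _ => hprod I,
    expectation_of_subset hsub hFU, expectation_biUnion]
  · refine Finset.prod_congr rfl fun a _ => ?_
    -- The probabilities `P.atom ∘ f a` are by definition those of `P.restrict sep.2 a`.
    rw [expectation_image (hinjOn a), Pr_eq_expectation]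
    refine expectation_congr fun I hI => truth_congr fun g hg => ?_
    rw [Finset.mem_filter, Finset.mem_image]
    exact ⟨fun ⟨_, g', hg', h'⟩ => hinjOn a (hI hg') hg h' ▸ hg', fun h => ⟨hg, g, h, rfl⟩⟩
  · intro a _ b _ hab
    rw [Finset.disjoint_left]
    rintro _ hga hgb
    obtain ⟨g, hg, rfl⟩ := Finset.mem_image.1 hga
    obtain ⟨g', hg', heq⟩ := Finset.mem_image.1 hgb
    exact hab (hinj b a g' hg' g hg heq).1.symm
  · exact fun a _ => hF a

end

/-! ## The queries of recursive calls -/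

/-- The clauses of `Q` are ranked, have at most `M` literals, and their predicates are in `Sy`. -/
def CNF.Within (Q : CNF ρ) (Sy : Finset (ρ × ℕ)) (M : ℕ) : Prop :=
  ∀ C ∈ Q, C.Ranked ∧ C.card ≤ M ∧ ∀ l ∈ C, l.symbol ∈ Sy

theorem CNF.Within.ranked {Q : CNF ρ} {Sy : Finset (ρ × ℕ)} {M : ℕ} (h : Q.Within Sy M) :
    Q.Ranked := fun C hC => (h C hC).1

theorem CNF.Within.of_subset {Q Q' : CNF ρ} {Sy : Finset (ρ × ℕ)} {M : ℕ} (h : Q.Within Sy M)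
    (hsub : ∀ C ∈ Q', ∃ C' ∈ Q, C ⊆ C') : Q'.Within Sy M := fun C hC => by
  obtain ⟨C', hC', hCC'⟩ := hsub C hC
  obtain ⟨h1, h2, h3⟩ := h C' hC'
  exact ⟨fun l hl => h1 l (hCC' hl), (Finset.card_le_card hCC').trans h2,
    fun l hl => h3 l (hCC' hl)⟩

section

variable [DecidableEq ρ]

theorem CNF.Within.symbols_subset {Q : CNF ρ} {Sy : Finset (ρ × ℕ)} {M : ℕ} (h : Q.Within Sy M) :
    Q.symbols ⊆ Sy := fun s hs => by
  obtain ⟨C, hC, l, hl, rfl⟩ := mem_symbols.1 hs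
  exact (h C hC).2.2 l hl

theorem CNF.Ranked.within {Q : CNF ρ} (h : Q.Ranked) :
    Q.Within Q.symbols (Q.sup Finset.card) := fun C hC =>
  ⟨h C hC, Finset.le_sup (f := Finset.card) hC, fun _ hl => symbol_mem_symbols hC hl⟩

theorem CNF.Within.trans {Q Q' : CNF ρ} {Sy : Finset (ρ × ℕ)} {M : ℕ}
    (h' : Q'.Within Q.symbols (Q.sup Finset.card)) (h : Q.Within Sy M) : Q'.Within Sy M :=
  fun C hC => by
    obtain ⟨h1, h2, h3⟩ := h' C hC
    exact ⟨h1, h2.trans (Finset.sup_le fun C hC => (h C hC).2.1),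
      fun l hl => h.symbols_subset (h3 l hl)⟩

theorem CNF.maxArity_mono {Q Q' : CNF ρ} (h : Q'.symbols ⊆ Q.symbols) :
    Q'.maxArity ≤ Q.maxArity := Finset.sup_mono h

/-! ### The members of a union-CNF. -/

theorem Subsumes.symbol_mem {D C : Clause ρ} {Q : CNF ρ} (h : Subsumes D C) (hC : C ∈ Q)
    {l : Literal ρ} (hl : l ∈ D) : l.symbol ∈ Q.symbols := by
  obtain ⟨⟨σ, hσ⟩, -⟩ := h
  rw [← Literal.symbol_rename σ l]
  exact symbol_mem_symbols hC (hσ (Finset.mem_image_of_mem _ hl))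

/-- An added component subsumes a clause of `Q`, so it is no longer than that clause and has no
other predicates. This keeps inclusion/exclusion inside a set of clauses that is finite up to
equivalence. -/
theorem within_of_mem_distribute {𝒞 : Finset (Clause ρ)} {Q d : CNF ρ} (hQ : Q.Ranked)
    (h𝒞 : ∀ C ∈ 𝒞, IsSplitting Q C) (hd : d ∈ distribute 𝒞 Q) :
    d.Within Q.symbols (Q.sup Finset.card) := by
  obtain ⟨f, hf, rfl⟩ := Finset.mem_image.1 hd
  intro E hE
  rcases Finset.mem_union.1 hE with hE | hE
  · exact hQ.within E hE
  · obtain ⟨⟨C, hC⟩, -, rfl⟩ := Finset.mem_image.1 hE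
    have hcomp := Finset.mem_pi.1 hf C hC
    obtain ⟨h1, -, -, h2⟩ := h𝒞 C hC
    obtain ⟨C', hC', hsub⟩ := h2 _ hcomp
    exact ⟨fun l hl => h1 l ((mem_components.1 hcomp).1.1 hl),
      hsub.2.trans (Finset.le_sup (f := Finset.card) hC'), fun l hl => hsub.symbol_mem hC' hl⟩

theorem IsUnionCNF.within {simplify : CNF ρ → CNF ρ} (hs : ∀ Q, IsSimplification Q (simplify Q))
    {Q : CNF ρ} {U : List (CNF ρ)} (hQ : Q.Ranked) (hU : IsUnionCNF simplify Q U) :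
    ∀ q ∈ U, q.Within Q.symbols (Q.sup Finset.card) := by
  obtain ⟨𝒞, h1, -, h2, -⟩ := hU
  intro q hq
  obtain ⟨d, hd, rfl⟩ := h2 q hq
  exact (within_of_mem_distribute hQ h1 hd).of_subset (hs d).2.1

theorem IsUnionCNF.entails {simplify : CNF ρ → CNF ρ} (hs : ∀ Q, IsSimplification Q (simplify Q))
    {Q : CNF ρ} {U : List (CNF ρ)} (hU : IsUnionCNF simplify Q U) : ∀ q ∈ U, Entails q Q := by
  obtain ⟨𝒞, -, -, h2, -⟩ := hU
  intro q hq
  obtain ⟨d, hd, rfl⟩ := h2 q hq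
  refine (hs d).1.2.trans fun D _ I hI C hC => hI C ?_
  obtain ⟨f, -, rfl⟩ := Finset.mem_image.1 hd
  exact Finset.mem_union_left _ hC

/-- In a given model of `Q` each implicate in `𝒞` has a true component; choosing one for each gives
a disjunct of the distributed form that is true there. -/
theorem IsUnionCNF.exists_holds {simplify : CNF ρ → CNF ρ} {Q : CNF ρ} {U : List (CNF ρ)}
    (hU : IsUnionCNF simplify Q U) {D : Type} [Nonempty D] {I : World ρ D} (hI : Q.Holds I) :
    ∃ q ∈ U, q.Holds I := by
  obtain ⟨𝒞, h1, -, -, h2, -⟩ := hU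
  have h : ∀ C, ∃ S, C ∈ 𝒞 → S ∈ components C ∧ Clause.Holds I S := by
    intro C
    by_cases hC : C ∈ 𝒞
    · obtain ⟨S, hS⟩ := (holds_iff_exists_component I C).1
        ((h1 C hC).2.1.1 D I hI C (Finset.mem_singleton_self _))
      exact ⟨S, fun _ => hS⟩
    · exact ⟨∅, fun h => absurd h hC⟩
  choose f hf using h
  obtain ⟨q, hq, hdq⟩ := h2 _ (Finset.mem_image_of_mem _
    (Finset.mem_pi.2 fun C hC => (hf C hC).1 : (fun C _ => f C) ∈ 𝒞.pi fun C => components C))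
  refine ⟨q, hq, hdq D I fun E hE => ?_⟩
  rcases Finset.mem_union.1 hE with hE | hE
  · exact hI E hE
  · obtain ⟨⟨C, hC⟩, -, rfl⟩ := Finset.mem_image.1 hE
    exact (hf C hC).2

theorem IsUnionCNF.holds_iff {simplify : CNF ρ → CNF ρ}
    (hs : ∀ Q, IsSimplification Q (simplify Q)) {Q : CNF ρ} {U : List (CNF ρ)}
    (hU : IsUnionCNF simplify Q U) {D : Type} [Nonempty D] {I : World ρ D} :
    Q.Holds I ↔ ∃ q ∈ U, q.Holds I :=
  ⟨hU.exists_holds, fun ⟨q, hq, h⟩ => hU.entails hs q hq D I h⟩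

/-- The members of a proper union are pairwise incomparable. -/
theorem IsUnionCNF.exists_not_entails {simplify : CNF ρ → CNF ρ} {Q : CNF ρ} {U : List (CNF ρ)}
    (hU : IsUnionCNF simplify Q U) (h1 : 1 < U.length) {q : CNF ρ} (hq : q ∈ U) :
    ∃ q' ∈ U, ¬ Entails q q' ∧ ¬ Entails q' q := by
  obtain ⟨-, -, -, -, -, hp⟩ := hU
  rw [List.pairwise_iff_getElem] at hp
  obtain ⟨i, hi, rfl⟩ := List.getElem_of_mem hq
  rcases Nat.eq_zero_or_pos i with rfl | hi0
  · exact ⟨U[1], List.getElem_mem _, hp 0 1 hi h1 Nat.zero_lt_one⟩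
  · exact ⟨U[0], List.getElem_mem _, (hp 0 i (by omega) hi hi0).symm⟩

/-- Otherwise an incomparable member, which entails `Q`, would entail `q`. This strictness drives
the termination of inclusion/exclusion. -/
theorem IsUnionCNF.not_entails {simplify : CNF ρ → CNF ρ}
    (hs : ∀ Q, IsSimplification Q (simplify Q)) {Q : CNF ρ} {U : List (CNF ρ)}
    (hU : IsUnionCNF simplify Q U) (h1 : 1 < U.length) {q : CNF ρ} (hq : q ∈ U) :
    ¬ Entails Q q := fun h => by
  obtain ⟨q', hq', -, h'⟩ := hU.exists_not_entails h1 hq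
  exact h' ((hU.entails hs q' hq').trans h)

theorem symbols_nonempty_of_nonempty {Q : CNF ρ} (h : Q.Nonempty) (h' : ∅ ∉ Q) :
    Q.symbols.Nonempty := by
  obtain ⟨C, hC⟩ := h
  obtain ⟨l, hl⟩ := Finset.nonempty_iff_ne_empty.2 fun h => h' (h ▸ hC)
  exact ⟨_, symbol_mem_symbols hC hl⟩

/-- A query without predicates is valid or unsatisfiable, hence comparable to every other member. So
each side of a union partition owns a predicate that the other side lacks. -/
theorem IsUnionCNF.symbols_nonempty {simplify : CNF ρ → CNF ρ}
    (hs : ∀ Q, IsSimplification Q (simplify Q)) {Q : CNF ρ} {U : List (CNF ρ)}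
    (hU : IsUnionCNF simplify Q U) (h1 : 1 < U.length) {q : CNF ρ} (hq : q ∈ U) :
    q.symbols.Nonempty := by
  refine symbols_nonempty_of_nonempty (Finset.nonempty_iff_ne_empty.2 ?_) ?_
  · rintro rfl
    exact hU.not_entails hs h1 hq fun D _ I _ C hC => absurd hC (Finset.notMem_empty C)
  · intro h
    obtain ⟨q', -, h', -⟩ := hU.exists_not_entails h1 hq
    exact h' fun D _ I hI => absurd hI (not_holds_of_empty_mem h)

/-! ### Conjunctions, disjunctions and instantiations. -/

theorem within_conjunction {U : List (CNF ρ)} {Sy : Finset (ρ × ℕ)} {M : ℕ}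
    (h : ∀ q ∈ U, q.Within Sy M) (s : Finset (Fin U.length)) : (conjunction U s).Within Sy M := by
  intro C hC
  obtain ⟨i, -, hi⟩ := Finset.mem_biUnion.1 hC
  exact h _ (List.get_mem U i) C hi

theorem conjunction_entails {U : List (CNF ρ)} {s : Finset (Fin U.length)} {i : Fin U.length}
    (hi : i ∈ s) : Entails (conjunction U s) (U.get i) := fun _ _ _ h =>
  holds_conjunction.1 h i hi

theorem forall_mem_disjunction {U : List (CNF ρ)} {p : Literal ρ → Prop}
    (hp : ∀ m l, p l → p (l.rename (· + m))) (h : ∀ q ∈ U, ∀ C ∈ q, ∀ l ∈ C, p l) :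
    ∀ C ∈ disjunction U, ∀ l ∈ C, p l := by
  induction U with
  | nil =>
    intro C hC l hl
    rw [Finset.mem_singleton.1 hC] at hl
    exact absurd hl (Finset.notMem_empty l)
  | cons q U ih =>
    intro C hC l hl
    obtain ⟨C₁, hC₁, C₂, hC₂, rfl⟩ := Finset.mem_image₂.1 hC
    rcases Finset.mem_union.1 hl with hl | hl
    · exact h q List.mem_cons_self C₁ hC₁ l hl
    · obtain ⟨l, hl', rfl⟩ := Finset.mem_image.1 hl
      exact hp _ _ (ih (fun q hq => h q (List.mem_cons_of_mem _ hq)) C₂ hC₂ l hl')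

theorem ranked_disjunction {U : List (CNF ρ)} (h : ∀ q ∈ U, q.Ranked) : (disjunction U).Ranked :=
  forall_mem_disjunction
    (fun m _ hl => List.pairwise_map.2 (hl.imp fun h => Nat.add_lt_add_right h m)) h

theorem exists_mem_symbols_of_mem_disjunction {U : List (CNF ρ)} {s : ρ × ℕ}
    (hs : s ∈ (disjunction U).symbols) : ∃ q ∈ U, s ∈ q.symbols := by
  obtain ⟨C, hC, l, hl, rfl⟩ := mem_symbols.1 hs
  exact forall_mem_disjunction (p := fun l => ∃ q ∈ U, l.symbol ∈ q.symbols)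
    (fun m l hl => by rwa [Literal.symbol_rename])
    (fun q hq C hC l hl => ⟨q, hq, symbol_mem_symbols hC hl⟩) C hC l hl

theorem symbols_disjunction_ssubset {U : List (CNF ρ)} {Sy : Finset (ρ × ℕ)} {q' : CNF ρ}
    (h : ∀ q ∈ U, q.symbols ⊆ Sy) (h' : q'.symbols ⊆ Sy) (hne : q'.symbols.Nonempty)
    (hd : ∀ q ∈ U, Disjoint q.symbols q'.symbols) : (disjunction U).symbols ⊂ Sy := by
  obtain ⟨s, hs⟩ := hne
  refine (Finset.ssubset_iff_of_subset fun r hr => ?_).2 ⟨s, h' hs, fun hr => ?_⟩ <;>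
    obtain ⟨q, hq, hq'⟩ := exists_mem_symbols_of_mem_disjunction hr
  · exact h q hq hq'
  · exact Finset.disjoint_left.1 (hd q hq) hq' hs

theorem ranked_instantiate {Q : CNF ρ} (h : Q.Ranked) (pos : ρ → ℕ → ℕ) :
    (Q.instantiate pos).Ranked := by
  intro C' hC' l' hl'
  obtain ⟨C, hC, rfl⟩ := Finset.mem_image.1 hC'
  obtain ⟨l, hl, rfl⟩ := Finset.mem_image.1 hl'
  exact (h C hC l hl).sublist (List.eraseIdx_sublist _ _)

/-- All arities drop by one. The two side conditions provide a literal, without which the largest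
arity would already be `0`. -/
theorem IsSeparator.maxArity_instantiate {Q : CNF ρ} {sep : (Clause ρ → ℕ) × (ρ → ℕ → ℕ)}
    (h : IsSeparator Q sep) (hne : Q.Nonempty) (hemp : ∅ ∉ Q) :
    (Q.instantiate sep.2).maxArity + 1 ≤ Q.maxArity := by
  have hpos : 0 < Q.maxArity := by
    obtain ⟨s, hs⟩ := symbols_nonempty_of_nonempty hne hemp
    refine lt_of_lt_of_le ?_ (Finset.le_sup (f := Prod.snd) hs)
    obtain ⟨C, hC, l, hl, rfl⟩ := mem_symbols.1 hs
    exact (Nat.zero_le _).trans_lt (h.lt_length hC hl)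
  have : (Q.instantiate sep.2).maxArity ≤ Q.maxArity - 1 := Finset.sup_le fun s hs => by
    have : s.2 + 1 ≤ Q.maxArity := Finset.le_sup (f := Prod.snd) (h.symbols_instantiate hs).1
    omega
  omega

theorem IsSeparator.card_symbols_instantiate {Q : CNF ρ} {sep : (Clause ρ → ℕ) × (ρ → ℕ → ℕ)}
    (h : IsSeparator Q sep) : (Q.instantiate sep.2).symbols.card ≤ Q.symbols.card :=
  Finset.card_le_card_of_injOn (fun s => (s.1, s.2 + 1))
    (fun s hs => (h.symbols_instantiate (k := s.2) hs).1)
    fun s _ s' _ heq => by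
      simp only [Prod.mk.injEq, Nat.add_right_cancel_iff] at heq
      exact Prod.ext heq.1 heq.2

/-! ## Termination -/

/-- Induction along the recursive calls: a call has fewer predicates or smaller arities, or it
strictly strengthens the query without new predicates or longer clauses. -/
theorem ranked_induction {p : CNF ρ → Prop}
    (step : ∀ Q : CNF ρ, Q.Ranked →
      (∀ Q' : CNF ρ, Q'.Ranked →
        Q'.maxArity + Q'.symbols.card < Q.maxArity + Q.symbols.card → p Q') →
      (∀ Q' : CNF ρ, Q'.Within Q.symbols (Q.sup Finset.card) → Entails Q' Q → ¬ Entails Q Q' →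
        p Q') → p Q)
    (Q : CNF ρ) (hQ : Q.Ranked) : p Q := by
  classical
  induction hN : Q.maxArity + Q.symbols.card using Nat.strong_induction_on generalizing Q with
  | _ N ihN =>
  -- `B` is fixed for the whole inner induction, whose measure is the number of clauses of `B` that
  -- the current query does not imply.
  obtain ⟨B, hB⟩ := exists_small_clauses Q.symbols (Q.sup Finset.card)
  have key : ∀ m, ∀ Q' : CNF ρ, Q'.Within Q.symbols (Q.sup Finset.card) →
      (B.filter fun b => ¬ Entails Q' {b}).card = m → p Q' := by
    intro m
    induction m using Nat.strong_induction_on with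
    | _ m ihm =>
    intro Q' hQ' hm
    have hle : Q'.maxArity + Q'.symbols.card ≤ N := hN ▸ Nat.add_le_add
      (CNF.maxArity_mono hQ'.symbols_subset) (Finset.card_le_card hQ'.symbols_subset)
    refine step Q' hQ'.ranked (fun Q'' hQ'' hlt => ihN _ (hlt.trans_le hle) Q'' hQ'' rfl)
      fun Q'' hQ'' h1 h2 => ihm _ ?_ Q'' (hQ''.trans hQ') rfl
    rw [← hm]
    refine Finset.card_lt_card ((Finset.ssubset_iff_of_subset fun b hb => ?_).2 ?_)
    · rw [Finset.mem_filter] at hb ⊢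
      exact ⟨hb.1, fun h => hb.2 (h1.trans h)⟩
    -- Some clause of the stronger query is new; its representative in `B` is no longer counted.
    · have : ∃ C ∈ Q'', ¬ Entails Q' {C} := by
        by_contra hno
        push Not at hno
        exact h2 fun D _ I hI C hC => hno C hC D I hI C (Finset.mem_singleton_self C)
      obtain ⟨C, hC, hne⟩ := this
      obtain ⟨-, hM, hSy⟩ := (hQ''.trans hQ') C hC
      obtain ⟨b, hb, hCb⟩ := hB C hM hSy
      refine ⟨b, Finset.mem_filter.2 ⟨hb, fun h => hne (h.trans hCb.2)⟩, fun h => ?_⟩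
      exact (Finset.mem_filter.1 h).2
        (Entails.trans (fun D _ I hI => holds_singleton.2 (hI C hC)) hCb.1)
  exact key _ Q hQ.within rfl

end

/-! ## Computations -/

/-- Computations that halt with answer FAIL on all databases, if the recursion depth is large. -/
def Fails (o : ℕ → ∀ n, PDB ρ n → Outcome) : Prop :=
  ∃ d₀, ∀ d, d₀ ≤ d → ∀ n, 1 ≤ n → ∀ P, ∃ t, o d n P = .fail t

/-- Computations that return `v n P` in time `O(n ^ k)`, if the recursion depth is large. -/
def Succeeds (k : ℕ) (o : ℕ → ∀ n, PDB ρ n → Outcome) (v : ∀ n, PDB ρ n → ℝ) : Prop :=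
  ∃ d₀ c, ∀ d, d₀ ≤ d → ∀ n, 1 ≤ n → ∀ P, ∃ t, o d n P = .value (v n P) t ∧ t ≤ c * n ^ k

/-- The same alternative holds for all databases at once. Since both alternatives speak of all
sufficiently large depths, several calls are combined by taking the maximum of their depths. -/
def Settles (k : ℕ) (o : ℕ → ∀ n, PDB ρ n → Outcome) (v : ∀ n, PDB ρ n → ℝ) : Prop :=
  Fails o ∨ Succeeds k o v

section

variable {k k' : ℕ} {o o' : ℕ → ∀ n, PDB ρ n → Outcome} {v v' : ∀ n, PDB ρ n → ℝ}

theorem Settles.mono (h : Settles k o v) (hk : k ≤ k') : Settles k' o v := by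
  refine h.imp id fun ⟨d₀, c, h⟩ => ⟨d₀, c, fun d hd n hn P => ?_⟩
  obtain ⟨t, h1, h2⟩ := h d hd n hn P
  exact ⟨t, h1, h2.trans (Nat.mul_le_mul_left c (Nat.pow_le_pow_right hn hk))⟩

theorem le_mul_pow {n : ℕ} (hn : 1 ≤ n) (m k : ℕ) : m ≤ m * n ^ k :=
  Nat.le_mul_of_pos_right m (Nat.pow_pos hn)

theorem settles_value (k : ℕ) (v : ∀ n, PDB ρ n → ℝ) (m : ℕ) :
    Settles k (fun _ n P => .value (v n P) m) v :=
  .inr ⟨0, m, fun _ _ _ hn _ => ⟨m, rfl, le_mul_pow hn m k⟩⟩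

theorem settles_fail (k m : ℕ) (v : ∀ n, PDB ρ n → ℝ) : Settles k (fun _ _ _ => .fail m) v :=
  .inl ⟨0, fun _ _ _ _ _ => ⟨m, rfl⟩⟩

/-- One level of the recursion. -/
theorem Settles.of_step (h : Settles k o' v') (m : ℕ)
    (ho : ∀ d n P, o (d + 1) n P = (o' d n P).delay m)
    (hv : ∀ n, 1 ≤ n → ∀ P, v n P = v' n P) : Settles k o v := by
  rcases h with ⟨d₀, h⟩ | ⟨d₀, c, h⟩
  · refine .inl ⟨d₀ + 1, fun d hd n hn P => ?_⟩
    obtain ⟨d, rfl⟩ := Nat.exists_eq_add_of_le' (Nat.le_of_add_left_le hd)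
    obtain ⟨t, ht⟩ := h d (Nat.le_of_add_le_add_right hd) n hn P
    exact ⟨m + t, by rw [ho, ht]; rfl⟩
  · refine .inr ⟨d₀ + 1, m + c, fun d hd n hn P => ?_⟩
    obtain ⟨d, rfl⟩ := Nat.exists_eq_add_of_le' (Nat.le_of_add_left_le hd)
    obtain ⟨t, ht, hle⟩ := h d (Nat.le_of_add_le_add_right hd) n hn P
    refine ⟨m + t, by rw [ho, ht, hv n hn]; rfl, ?_⟩
    rw [add_mul]
    exact Nat.add_le_add (le_mul_pow hn m k) hle

theorem Settles.map (h : Settles k o v) (f : ℝ → ℝ) (m : ℕ) :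
    Settles k (fun d n P => (o d n P).bind fun x => .value (f x) m) (fun n P => f (v n P)) := by
  rcases h with ⟨d₀, h⟩ | ⟨d₀, c, h⟩
  · refine .inl ⟨d₀, fun d hd n hn P => ?_⟩
    obtain ⟨t, ht⟩ := h d hd n hn P
    exact ⟨t, by simp only [ht]; rfl⟩
  · refine .inr ⟨d₀, c + m, fun d hd n hn P => ?_⟩
    obtain ⟨t, ht, hle⟩ := h d hd n hn P
    refine ⟨t + m, by simp only [ht]; rfl, ?_⟩
    rw [add_mul]
    exact Nat.add_le_add hle (le_mul_pow hn m k)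

/-- If the first computation fails, the second is irrelevant; if it succeeds, the second decides. -/
theorem Settles.map₂ (h : Settles k o v) (h' : Settles k o' v') (f : ℝ → ℝ → ℝ) (m : ℕ) :
    Settles k (fun d n P => (o d n P).bind fun x => (o' d n P).bind fun y => .value (f x y) m)
      (fun n P => f (v n P) (v' n P)) := by
  rcases h with ⟨d₀, h⟩ | ⟨d₀, c, h⟩
  · refine .inl ⟨d₀, fun d hd n hn P => ?_⟩
    obtain ⟨t, ht⟩ := h d hd n hn P
    exact ⟨t, by simp only [ht]; rfl⟩
  rcases h' with ⟨d₁, h'⟩ | ⟨d₁, c', h'⟩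
  · refine .inl ⟨max d₀ d₁, fun d hd n hn P => ?_⟩
    obtain ⟨t, ht, -⟩ := h d (le_of_max_le_left hd) n hn P
    obtain ⟨t', ht'⟩ := h' d (le_of_max_le_right hd) n hn P
    exact ⟨t + t', by simp only [ht, ht']; rfl⟩
  · refine .inr ⟨max d₀ d₁, c + (c' + m), fun d hd n hn P => ?_⟩
    obtain ⟨t, ht, hle⟩ := h d (le_of_max_le_left hd) n hn P
    obtain ⟨t', ht', hle'⟩ := h' d (le_of_max_le_right hd) n hn P
    refine ⟨t + (t' + m), by simp only [ht, ht']; rfl, ?_⟩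
    rw [add_mul, add_mul]
    exact Nat.add_le_add hle (Nat.add_le_add hle' (le_mul_pow hn m k))

theorem settles_fold {ι : Type*} (f : ℝ → ℝ → ℝ) (init : ℝ) {L : List ι}
    {o : ι → ℕ → ∀ n, PDB ρ n → Outcome} {v : ι → ∀ n, PDB ρ n → ℝ}
    (h : ∀ i ∈ L, Settles k (o i) (v i)) :
    Settles k (fun d n P => Outcome.fold f init (L.map fun i => o i d n P))
      (fun n P => (L.map fun i => v i n P).foldr f init) := by
  induction L with
  | nil => exact settles_value k (fun _ _ => init) 0
  | cons i L ih =>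
    exact (h i List.mem_cons_self).map₂ (ih fun j hj => h j (List.mem_cons_of_mem _ hj)) f 1

/-- For the product over the domain the list grows with `n`, so a bound linear in its length is
needed, unlike in `settles_fold`, where the list is fixed. -/
theorem Outcome.fold_value {ι : Type*} (f : ℝ → ℝ → ℝ) (init : ℝ) {b : ℕ} {w : ι → ℝ}
    {o : ι → Outcome} (h : ∀ i, ∃ t, o i = .value (w i) t ∧ t ≤ b) (L : List ι) :
    ∃ t, Outcome.fold f init (L.map o) = .value ((L.map w).foldr f init) t ∧
      t ≤ L.length * (b + 1) := by
  induction L with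
  | nil => exact ⟨0, rfl, Nat.zero_le _⟩
  | cons i L ih =>
    obtain ⟨t, ht, hle⟩ := h i
    obtain ⟨t', ht', hle'⟩ := ih
    refine ⟨t + (t' + 1), ?_, ?_⟩
    · simp only [List.map_cons, Outcome.fold, ht, ht']
      rfl
    · rw [List.length_cons, add_mul, one_mul]
      omega

theorem sum_map_filter_eq {ι : Type*} {p : ι → Bool} {f : ι → ℝ} (h : ∀ i, p i = false → f i = 0)
    (L : List ι) : ((L.filter p).map f).sum = (L.map f).sum := by
  induction L with
  | nil => rfl
  | cons i L ih => cases hi : p i <;> simp [hi, ih, h]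

/-- A product over the domain. -/
theorem Settles.prod (h : Settles k o v) (pos : ρ → ℕ → ℕ) :
    Settles (k + 1)
      (fun d n P => Outcome.fold (· * ·) 1
        ((List.finRange n).map fun a => o d n (P.restrict pos a)))
      (fun n P => ∏ a : Fin n, v n (P.restrict pos a)) := by
  rcases h with ⟨d₀, h⟩ | ⟨d₀, c, h⟩
  · refine .inl ⟨d₀, fun d hd n hn P => ?_⟩
    -- A nonempty domain has a first factor, and its failure ends the call; an empty product would
    -- succeed.
    obtain ⟨m, rfl⟩ := Nat.exists_eq_add_of_le' hn
    obtain ⟨t, ht⟩ := h d hd _ hn (P.restrict pos 0)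
    exact ⟨t, by simp only [List.finRange_succ, List.map_cons, Outcome.fold, ht]; rfl⟩
  -- There are `n` factors, each costing at most `c * n ^ k` and one multiplication, and `1 ≤ n ^
  -- k`.
  · refine .inr ⟨d₀, c + 1, fun d hd n hn P => ?_⟩
    obtain ⟨t, ht, hle⟩ := Outcome.fold_value (· * ·) 1
      (fun a => h d hd n hn (P.restrict pos a)) (List.finRange n)
    refine ⟨t, ?_, hle.trans ?_⟩
    · simp only [ht]
      rw [← List.prod, ← Fin.prod_univ_def]
    · have h1 := Nat.pow_pos (n := k) hn
      rw [List.length_finRange, pow_succ, ← mul_assoc, mul_comm n]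
      exact Nat.mul_le_mul_right n (by rw [add_mul, one_mul]; omega)

end

/-! ## The algorithm -/

section

variable [DecidableEq ρ] (S : Implementation ρ)

/-- The algorithm on `Q` fails, or it computes the probability of `Q` in polynomial time. -/
def Settled (Q : CNF ρ) : Prop :=
  Settles Q.maxArity (fun d _ P => lift S d Q P) (fun _ P => Pr P Q)

variable {S}

theorem Settled.le {Q' : CNF ρ} (h : Settled S Q') {k : ℕ} (hk : Q'.maxArity ≤ k) :
    Settles k (fun d _ P => lift S d Q' P) (fun _ P => Pr P Q') := Settles.mono h hk

/-- In each case the tests depend on the query only, so one branch of the algorithm is taken for all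
databases. `ih₁` serves the partition and separator rules, `ih₂` the inclusion/exclusion rule. -/
theorem settled_step {Q₀ : CNF ρ} (hQ₀ : Q₀.Ranked)
    (ih₁ : ∀ Q' : CNF ρ, Q'.Ranked →
      Q'.maxArity + Q'.symbols.card < Q₀.maxArity + Q₀.symbols.card → Settled S Q')
    (ih₂ : ∀ Q' : CNF ρ, Q'.Within Q₀.symbols (Q₀.sup Finset.card) → Entails Q' Q₀ →
      ¬ Entails Q₀ Q' → Settled S Q') : Settled S Q₀ := by
  have hs := S.simplify_spec Q₀
  have hU := S.union_spec (S.simplify Q₀)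
  -- The right-hand side is whatever one unfolding yields. Generalizing the choices made by `S` then
  -- leaves only their specifications.
  have hlift : ∀ d n (P : PDB ρ n), lift S (d + 1) Q₀ P = _ := fun d n P => by rw [lift]
  generalize S.simplify Q₀ = Q at hs hU hlift
  generalize S.union Q = U at hU hlift
  have hW : Q.Within Q₀.symbols (Q₀.sup Finset.card) := hQ₀.within.of_subset hs.2.1
  have hPr : ∀ n, 1 ≤ n → ∀ P : PDB ρ n, Pr P Q₀ = Pr P Q := fun n hn P => Pr_congr hn P hs.1
  have ih_symbols : ∀ Q' : CNF ρ, Q'.Ranked → Q'.symbols ⊂ Q₀.symbols →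
      Settles Q₀.maxArity (fun d _ P => lift S d Q' P) (fun _ P => Pr P Q') := fun Q' hQ' hsub => by
    have h := CNF.maxArity_mono hsub.1
    exact (ih₁ Q' hQ' (Nat.add_lt_add_of_le_of_lt h (Finset.card_lt_card hsub))).le h
  by_cases h0 : Q = ∅
  · refine (settles_value _ (fun _ _ => 1) 0).of_step (S.work Q₀ + 1) (fun d n P => ?_)
      fun n hn P => ?_
    · rw [hlift]
      simp only [h0, if_true]
    · rw [hPr n hn, h0, Pr_empty]
  by_cases h1 : ∅ ∈ Q
  · refine (settles_value _ (fun _ _ => 0) 0).of_step (S.work Q₀ + 1) (fun d n P => ?_)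
      fun n hn P => ?_
    · rw [hlift]
      simp only [h0, h1, if_true, if_false]
    · rw [hPr n hn, Pr_of_empty_mem hn P h1]
  by_cases h2 : ∃ l : Literal ρ, Q = {{l}} ∧ l.args = []
  · refine (settles_value _ (fun _ P => P.literal h2.choose) 2).of_step (S.work Q₀ + 1)
      (fun d n P => ?_) fun n hn P => ?_
    · rw [hlift]
      simp only [h0, h1, h2, if_false, dif_pos]
    · obtain ⟨h3, h4⟩ := h2.choose_spec
      rw [hPr n hn, ← Pr_literal hn P h4, ← h3]
  by_cases h3 : 1 < U.length
  · have hUW : ∀ q ∈ U, q.Within Q₀.symbols (Q₀.sup Finset.card) := fun q hq =>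
      (hU.within S.simplify_spec hW.ranked q hq).trans hW
    have hholds : ∀ n, 1 ≤ n → ∀ I : World ρ (Fin n), Q.Holds I ↔ ∃ q ∈ U, q.Holds I :=
      fun n hn I => by
        have : Nonempty (Fin n) := ⟨⟨0, hn⟩⟩
        exact hU.holds_iff S.simplify_spec
    by_cases h4 : ∃ p, IsUnionPartition U p
    · have hp := S.unionPartition_spec U h4
      generalize S.unionPartition U = p at hp hlift
      obtain ⟨hp1, hp2, hperm, hdisj⟩ := hp
      have hmem : ∀ q, q ∈ U ↔ q ∈ p.1 ∨ q ∈ p.2 := fun q => by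
        rw [hperm.mem_iff, List.mem_append]
      obtain ⟨q₁, hq₁⟩ := List.exists_mem_of_ne_nil _ hp1
      obtain ⟨q₂, hq₂⟩ := List.exists_mem_of_ne_nil _ hp2
      have hU1 := fun q hq => hUW q ((hmem q).2 (.inl hq))
      have hU2 := fun q hq => hUW q ((hmem q).2 (.inr hq))
      have hne := fun q hq => hU.symbols_nonempty S.simplify_spec h3 (q := q) hq
      refine Settles.of_step (Settles.map₂
        (ih_symbols _ (ranked_disjunction fun q hq => (hU1 q hq).ranked)
          (symbols_disjunction_ssubset (fun q hq => (hU1 q hq).symbols_subset)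
            (hU2 q₂ hq₂).symbols_subset (hne q₂ ((hmem q₂).2 (.inr hq₂)))
            fun q hq => hdisj q hq q₂ hq₂))
        (ih_symbols _ (ranked_disjunction fun q hq => (hU2 q hq).ranked)
          (symbols_disjunction_ssubset (fun q hq => (hU2 q hq).symbols_subset)
            (hU1 q₁ hq₁).symbols_subset (hne q₁ ((hmem q₁).2 (.inl hq₁)))
            fun q hq => (hdisj q₁ hq₁ q hq).symm))
        (fun x y => 1 - (1 - x) * (1 - y)) 4) (S.work Q₀ + 1) (fun d n P => ?_) fun n hn P => ?_
      · rw [hlift]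
        simp only [h0, h1, h2, h3, h4, if_true, if_false, dif_neg, not_false_eq_true]
      · have : Nonempty (Fin n) := ⟨⟨0, hn⟩⟩
        rw [hPr n hn]
        refine Pr_of_or P (Finset.disjoint_left.2 fun s hs hs' => ?_) fun I => ?_
        · obtain ⟨q, hq, hsq⟩ := exists_mem_symbols_of_mem_disjunction hs
          obtain ⟨q', hq', hsq'⟩ := exists_mem_symbols_of_mem_disjunction hs'
          exact Finset.disjoint_left.1 (hdisj q hq q' hq') hsq hsq'
        · simp only [hholds n hn, holds_disjunction, hmem, or_and_right, exists_or]
    · have hT := S.terms_spec U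
      generalize S.terms U = T at hT hlift
      -- Terms are filtered before the calls, so a cancelled query is never run and cannot cause
      -- failure; `sum_map_filter_eq` shows that the sum is unaffected.
      refine Settles.of_step (settles_fold (· + ·) 0
        (L := T.filter fun q => coefficient U q ≠ 0) fun q hq =>
          (Settled.le (ih₂ q ?_ ?_ ?_) ?_).map (fun x => coefficient U q * x) 1)
        (S.work Q₀ + 1) (fun d n P => ?_) fun n hn P => ?_
      · obtain ⟨s, -, rfl⟩ := hT.1 q (List.mem_of_mem_filter hq)
        exact within_conjunction hUW s
      · obtain ⟨s, ⟨i, hi⟩, rfl⟩ := hT.1 q (List.mem_of_mem_filter hq)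
        exact (conjunction_entails hi).trans
          ((hU.entails S.simplify_spec _ (List.get_mem U i)).trans hs.1.2)
      · obtain ⟨s, ⟨i, hi⟩, rfl⟩ := hT.1 q (List.mem_of_mem_filter hq)
        exact fun h => hU.not_entails S.simplify_spec h3 (List.get_mem U i)
          (hs.1.2.trans (h.trans (conjunction_entails hi)))
      · obtain ⟨s, -, rfl⟩ := hT.1 q (List.mem_of_mem_filter hq)
        exact CNF.maxArity_mono (within_conjunction hUW s).symbols_subset
      · rw [hlift]
        simp only [h0, h1, h2, h3, h4, if_true, if_false, dif_neg, not_false_eq_true]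
      · rw [hPr n hn, Pr_eq_sum_terms hn P (hholds n hn) hT, ← List.sum]
        exact (sum_map_filter_eq fun q hq => by simp_all) T |>.symm
  by_cases h4 : ∃ p, IsClausePartition Q p
  · have hp := S.clausePartition_spec Q h4
    generalize S.clausePartition Q = p at hp hlift
    obtain ⟨hp1, hp2, rfl, hdisj⟩ := hp
    rw [Finset.mem_union, not_or] at h1
    have hsub := hW.symbols_subset
    rw [symbols_union] at hsub
    have hsub1 := Finset.union_subset_left hsub
    have hsub2 := Finset.union_subset_right hsub
    refine Settles.of_step (Settles.map₂
      (ih_symbols p.1 (fun C hC => hW.ranked C (Finset.mem_union_left _ hC)) ?_)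
      (ih_symbols p.2 (fun C hC => hW.ranked C (Finset.mem_union_right _ hC)) ?_)
      (· * ·) 1) (S.work Q₀ + 1) (fun d n P => ?_) fun n hn P => ?_
    · obtain ⟨s, hs⟩ := symbols_nonempty_of_nonempty hp2 h1.2
      exact (Finset.ssubset_iff_of_subset hsub1).2
        ⟨s, hsub2 hs, fun h => Finset.disjoint_left.1 hdisj h hs⟩
    · obtain ⟨s, hs⟩ := symbols_nonempty_of_nonempty hp1 h1.1
      exact (Finset.ssubset_iff_of_subset hsub2).2
        ⟨s, hsub1 hs, Finset.disjoint_left.1 hdisj hs⟩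
    · rw [hlift]
      simp only [h0, h1, h2, h3, h4, Finset.mem_union, or_self, if_true, if_false, dif_neg,
        not_false_eq_true]
    · rw [hPr n hn, Pr_union_of_disjoint P hdisj]
  by_cases h5 : ∃ sep, IsSeparator Q sep
  · have hsep := S.separator_spec Q h5
    have harity := hsep.maxArity_instantiate (Finset.nonempty_iff_ne_empty.2 h0) h1
    have hcard := hsep.card_symbols_instantiate
    have hmono := CNF.maxArity_mono hW.symbols_subset
    have hcard' := Finset.card_le_card hW.symbols_subset
    -- The arity drops by one while the number of predicates does not grow, so `ih₁` applies; the
    -- extra factor `n` uses up exactly this drop.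
    refine Settles.of_step ((Settles.prod (ih₁ (Q.instantiate (S.separator Q).2)
      (ranked_instantiate hW.ranked _) (by omega)) (S.separator Q).2).mono (harity.trans hmono))
      (S.work Q₀ + 1) (fun d n P => ?_) fun n hn P => ?_
    · rw [hlift]
      simp only [h0, h1, h2, h3, h4, h5, if_true, if_false, dif_neg, not_false_eq_true]
    · rw [hPr n hn, Pr_separator P hW.ranked hsep]
  · refine (settles_fail _ 0 _).of_step (S.work Q₀ + 1) (fun d n P => ?_) fun n hn P => rfl
    rw [hlift]
    simp only [h0, h1, h2, h3, h4, h5, if_false, dif_neg, not_false_eq_true]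

theorem settled (Q : CNF ρ) (hQ : Q.Ranked) : Settled S Q :=
  ranked_induction (fun _ h ih₁ ih₂ => settled_step h ih₁ ih₂) Q hQ

end

end LiftR

theorem mainTheorem1 {ρ : Type*} [DecidableEq ρ] (S : LiftR.Implementation ρ)
    (Q : LiftR.CNF ρ) (hQ : Q.Ranked) :
    LiftR.FailsOn S Q ∨
      ∃ c : ℕ, ∀ n : ℕ, 1 ≤ n → ∀ P : LiftR.PDB ρ n,
        ∃ t : ℕ, LiftR.Computes S Q P (LiftR.Pr P Q) t ∧ t ≤ c * n ^ Q.maxArity := by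
  rcases LiftR.settled (S := S) Q hQ with ⟨d, h⟩ | ⟨d, c, h⟩
  · exact .inl fun n hn P => ⟨d, h d le_rfl n hn P⟩
  · refine .inr ⟨c, fun n hn P => ?_⟩
    obtain ⟨t, ht, hle⟩ := h d le_rfl n hn P
    exact ⟨t, ⟨d, ht⟩, hle⟩
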